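/- **Theorem (optimality system for the Neumann problem).** Let $d\ge 1$ and let $\Omega\subset\mathbb R^d$ be a bounded domain (nonempty, open, connected) with Lipschitz boundary. Let $S_0,S_1\subset\Omega$ be disjoint measurable sets such that $\tilde\Omega:=\Omega\setminus(S_0\cup S_1)$ is open with Lipschitz boundary. Let $-1<\beta_1\le\beta_2<1$, and let the admissible set $\mathcal G^\beta\cap\mathcal U$ consist of all $\varphi\in L^\infty(\Omega)$ with $\varphi|_{\tilde\Omega}\in H^1(\tilde\Omega)$, $|\varphi|\le 1$ a.e. in $\tilde\Omega$, $\beta_1|\tilde\Omega|\le\int_{\tilde\Omega}\varphi\,dx\le\beta_2|\tilde\Omega|$, $\varphi=-1$ a.e. on $S_0$ and $\varphi=1$ a.e. on $S_1$. Fix $\varepsilon,\gamma>0$. Let $\psi_0\in C^{1,1}_{\mathrm{loc}}(\mathbb R)$ be such that $\psi=\psi_0+I_{[-1,1]}$ (with $I_{[-1,1]}=0$ on $[-1,1]$ and $+\infty$ elsewhere) has minimum $0$, attained exactly at $\pm1$, and a local maximum point in $(-1,1)$. Let $a_\varepsilon,c_\varepsilon\in C^{1,1}_{\mathrm{loc}}(\mathbb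 R)$ with $a_\varepsilon,c_\varepsilon>C_\varepsilon$ on $\mathbb R$ for some constant $C_\varepsilon>0$. For a bounded measurable weight $\kappa$ write $(u,v)_\kappa=\int_\Omega\kappa\,u\cdot v\,dx$ for scalar or vector valued $u,v$. For $\varphi\in L^\infty(\Omega)$, a real $\mu$ is a Neumann eigenvalue with eigenfunction $0\ne w\in H^1(\Omega)$ if $$(\nabla w,\nabla\eta)_{a_\varepsilon(\varphi)}=\mu\,(w,\eta)_{c_\varepsilon(\varphi)}\quad\text{for all }\eta\in H^1(\Omega).$$ Let $0=\mu_0^\varphi<\mu_1^\varphi\le\mu_2^\varphi\le\cdots$ be the Neumann eigenvalues in increasing order, repeated according to multiplicity; an eigenvalue is simple if its eigenspace is one-dimensional. Let $H^1_{(0),\varphi}(\Omega)=\{w\in H^1(\Omega):\int_\Omega c_\varepsilon(\varphi)w\,dx=0\}$. Let $l\in\mathbb N$, $0<i_1<\dots<i_l$ be integers, let $\Psi:(\mathbb R_{>0})^l\to\mathbb R$ be of class $C^1$, and put $$J(\varphi)=\Psi(\mu^\varphi_{i_1},\dots,\mu^\varphi_{i_l})+\gamma\int_{\tilde\Omega}\Big(\frac\varepsilon2|\nabla\varphi|^2+\frac1\varepsilon\psi_0(\varphi)\Big)dx.$$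 Let $\varphi\in\mathcal G^\beta\cap\mathcal U$ be a local minimizer, i.e. there is $\delta>0$ with $J(\vartheta)\ge J(\varphi)$ for all $\vartheta\in\mathcal G^\beta\cap\mathcal U$ with $\|\vartheta-\varphi\|_{L^\infty(\Omega)}<\delta$, and suppose that the eigenvalues $\mu^\varphi_{i_1},\dots,\mu^\varphi_{i_l}$ are simple. Then $\mu^\varphi_{i_j}>0$ for all $j$, there exist eigenfunctions $w_{i_j}\in H^1_{(0),\varphi}(\Omega)$ to $\mu^\varphi_{i_j}$ with $(w_{i_j},w_{i_j})_{c_\varepsilon(\varphi)}=1$, and for every choice of such eigenfunctions the following holds. * The state equations $-\nabla\cdot[a_\varepsilon(\varphi)\nabla w_{i_j}]=\mu^\varphi_{i_j}c_\varepsilon(\varphi)w_{i_j}$ in $\Omega$, $\partial w_{i_j}/\partial\nu=0$ on $\partial\Omega$, are fulfilled in the weak sense (the identity displayed above, for all $\eta\in H^1(\Omega)$) for all $j\in\{1,\dots,l\}$. * For all $\vartheta\in\mathcal G^\beta\cap\mathcal U$, $$0\le\gamma\varepsilon\int_{\tilde\Omega}\nabla\varphi\cdot\nabla(\vartheta-\varphi)\,dx+\frac\gamma\varepsilon\int_{\tilde\Omega}\psi_0'(\varphi)(\vartheta-\varphi)\,dx+\sum_{j=1}^l\partial_j\Psi(\mu^\varphi_{i_1},\dots,\mu^\varphi_{i_l})\Big((\nabla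 w_{i_j},\nabla w_{i_j})_{a_\varepsilon'(\varphi)(\vartheta-\varphi)}-\mu^\varphi_{i_j}(w_{i_j},w_{i_j})_{c_\varepsilon'(\varphi)(\vartheta-\varphi)}\Big).$$ -/

import Mathlib

open MeasureTheory Set Topology
open scoped ContDiff RealInnerProductSpace ENNReal NNReal

noncomputable section

namespace PhaseFieldNeumann

/-- The space `ℝ^d` with its Euclidean norm and Lebesgue measure. -/
abbrev Rn (d : ℕ) : Type := EuclideanSpace ℝ (Fin d)

variable {d : ℕ}

/-- `U` has a Lipschitz boundary: near each boundary point, and up to a choice of the vertical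
direction `e`, the set `U` is the strict epigraph of a Lipschitz function `g`. The vector
`y - ⟪e, y⟫ • e` is the orthogonal projection of `y` onto the hyperplane `e^⊥`, so only the
values of `g` on that hyperplane matter. -/
def HasLipschitzBoundary (U : Set (Rn d)) : Prop :=
  ∀ x ∈ frontier U, ∃ e : Rn d, ‖e‖ = 1 ∧ ∃ r : ℝ, 0 < r ∧ ∃ (L : ℝ≥0) (g : Rn d → ℝ),
    LipschitzWith L g ∧
      ∀ y ∈ Metric.ball x r, (y ∈ U ↔ g (y - ⟪e, y⟫ • e) < ⟪e, y⟫)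

/-- The class `C^{1,1}_loc(ℝ)`. -/
def C11Loc (f : ℝ → ℝ) : Prop :=
  ContDiff ℝ 1 f ∧ LocallyLipschitz (deriv f)

/-- The potential `ψ = ψ₀ + I_{[-1,1]}` with values in `ℝ ∪ {+∞}`. -/
def obstaclePotential (ψ₀ : ℝ → ℝ) (s : ℝ) : EReal :=
  open Classical in (ψ₀ s : EReal) + (if s ∈ Icc (-1 : ℝ) 1 then 0 else ⊤)

/-- The assumptions on the potential: `ψ₀` is `C^{1,1}_loc`, and `ψ = ψ₀ + I_{[-1,1]}` has minimum
`0`, attained exactly at `±1`, and a local maximum point in between. -/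
structure IsDoubleObstacle (ψ₀ : ℝ → ℝ) : Prop where
  regular : C11Loc ψ₀
  nonneg : ∀ s, 0 ≤ obstaclePotential ψ₀ s
  eq_zero_iff : ∀ s, obstaclePotential ψ₀ s = 0 ↔ s = -1 ∨ s = 1
  exists_localMax : ∃ m ∈ Ioo (-1 : ℝ) 1, IsLocalMax (obstaclePotential ψ₀) m

/-- `G` is the weak gradient of `u` on `U`, tested with smooth functions compactly supported
in `U`. -/
def HasWeakGradient (U : Set (Rn d)) (u : Rn d → ℝ) (G : Rn d → Rn d) : Prop :=
  ∀ ζ : Rn d → ℝ, ContDiff ℝ ∞ ζ → HasCompactSupport ζ → tsupport ζ ⊆ U →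
    ∀ v : Rn d, ∫ x in U, u x * fderiv ℝ ζ x v = - ∫ x in U, ⟪G x, v⟫ * ζ x

theorem integrable_mul_fderiv {U : Set (Rn d)} {u : Rn d → ℝ}
    (hu : MemLp u 2 (volume.restrict U)) {ζ : Rn d → ℝ} (hζ : ContDiff ℝ ∞ ζ)
    (hc : HasCompactSupport ζ) (v : Rn d) :
    Integrable (fun x => u x * fderiv ℝ ζ x v) (volume.restrict U) := by
  have h1 : Continuous (fun x => fderiv ℝ ζ x v) :=
    (hζ.continuous_fderiv (by simp)).clm_apply continuous_const
  have h2 : HasCompactSupport (fun x => fderiv ℝ ζ x v) := hc.fderiv_apply ℝ v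
  exact hu.integrable_mul (h1.memLp_of_hasCompactSupport (p := 2) h2)

theorem integrable_inner_mul {U : Set (Rn d)} {G : Rn d → Rn d}
    (hG : MemLp G 2 (volume.restrict U)) {ζ : Rn d → ℝ} (hζ : ContDiff ℝ ∞ ζ)
    (hc : HasCompactSupport ζ) (v : Rn d) :
    Integrable (fun x => ⟪G x, v⟫ * ζ x) (volume.restrict U) :=
  (hG.inner_const v).integrable_mul (hζ.continuous.memLp_of_hasCompactSupport (p := 2) hc)

/-- The Sobolev space `H¹(U)`, realised as the space of pairs `(u, ∇u)` in `L²(U) × L²(U; ℝ^d)`;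
the inherited inner product is the usual one of `H¹(U)`. -/
def H1 (U : Set (Rn d)) :
    Submodule ℝ (WithLp 2 (Lp ℝ 2 (volume.restrict U) × Lp (Rn d) 2 (volume.restrict U))) where
  carrier := {p | HasWeakGradient U p.fst p.snd}
  zero_mem' := by
    intro ζ _ _ _ v
    have h1 : (fun x => (0 : Lp ℝ 2 (volume.restrict U)) x * fderiv ℝ ζ x v)
        =ᵐ[volume.restrict U] fun _ => (0 : ℝ) := by
      filter_upwards [Lp.coeFn_zero ℝ 2 (volume.restrict U)] with x hx
      rw [hx]; simp
    have h2 : (fun x => ⟪(0 : Lp (Rn d) 2 (volume.restrict U)) x, v⟫ * ζ x)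
        =ᵐ[volume.restrict U] fun _ => (0 : ℝ) := by
      filter_upwards [Lp.coeFn_zero (Rn d) 2 (volume.restrict U)] with x hx
      rw [hx]; simp
    simp only [WithLp.zero_fst, WithLp.zero_snd]
    rw [integral_congr_ae h1, integral_congr_ae h2]
    simp
  add_mem' := by
    intro p q hp hq ζ hζ hc hs v
    have h1 : (fun x => (p.fst + q.fst) x * fderiv ℝ ζ x v)
        =ᵐ[volume.restrict U]
          fun x => p.fst x * fderiv ℝ ζ x v + q.fst x * fderiv ℝ ζ x v := by
      filter_upwards [Lp.coeFn_add p.fst q.fst] with x hx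
      rw [hx]; simp [add_mul]
    have h2 : (fun x => ⟪(p.snd + q.snd) x, v⟫ * ζ x)
        =ᵐ[volume.restrict U] fun x => ⟪p.snd x, v⟫ * ζ x + ⟪q.snd x, v⟫ * ζ x := by
      filter_upwards [Lp.coeFn_add p.snd q.snd] with x hx
      rw [hx]; simp [inner_add_left, add_mul]
    simp only [WithLp.add_fst, WithLp.add_snd]
    rw [integral_congr_ae h1, integral_congr_ae h2,
      integral_add (integrable_mul_fderiv (Lp.memLp p.fst) hζ hc v)
        (integrable_mul_fderiv (Lp.memLp q.fst) hζ hc v),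
      integral_add (integrable_inner_mul (Lp.memLp p.snd) hζ hc v)
        (integrable_inner_mul (Lp.memLp q.snd) hζ hc v),
      hp ζ hζ hc hs v, hq ζ hζ hc hs v]
    ring
  smul_mem' := by
    intro t p hp ζ hζ hc hs v
    have h1 : (fun x => (t • p.fst) x * fderiv ℝ ζ x v)
        =ᵐ[volume.restrict U] fun x => t * (p.fst x * fderiv ℝ ζ x v) := by
      filter_upwards [Lp.coeFn_smul t p.fst] with x hx
      rw [hx]; simp [mul_assoc]
    have h2 : (fun x => ⟪(t • p.snd) x, v⟫ * ζ x)
        =ᵐ[volume.restrict U] fun x => t * (⟪p.snd x, v⟫ * ζ x) := by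
      filter_upwards [Lp.coeFn_smul t p.snd] with x hx
      rw [hx]; simp [real_inner_smul_left, mul_assoc]
    simp only [WithLp.smul_fst, WithLp.smul_snd]
    rw [integral_congr_ae h1, integral_congr_ae h2, integral_const_mul, integral_const_mul,
      hp ζ hζ hc hs v]
    ring

/-- The underlying `L²` function of an element of `H¹(U)`. -/
def valH1 {U : Set (Rn d)} (w : H1 U) : Lp ℝ 2 (volume.restrict U) := w.1.fst

/-- The weak gradient of an element of `H¹(U)`. -/
def gradH1 {U : Set (Rn d)} (w : H1 U) : Lp (Rn d) 2 (volume.restrict U) := w.1.snd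

/-- The function `u` belongs to `H¹(U)`. -/
def MemH1 (U : Set (Rn d)) (u : Rn d → ℝ) : Prop :=
  ∃ w : H1 U, u =ᵐ[volume.restrict U] valH1 w

/-- The weak gradient on `U` of a function in `H¹(U)` (and `0` for any other function). -/
def weakGrad (U : Set (Rn d)) (u : Rn d → ℝ) : Lp (Rn d) 2 (volume.restrict U) :=
  open Classical in if h : MemH1 U u then gradH1 h.choose else 0

/-- The space `L^∞(Ω)`. -/
abbrev LInf (Ω : Set (Rn d)) : Type := Lp ℝ ∞ (volume.restrict Ω)

/-- The weighted form `(u, v)_κ = ∫_Ω κ u · v dx`, for scalar or vector valued `u`, `v`. -/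
def wform {F : Type*} [NormedAddCommGroup F] [InnerProductSpace ℝ F]
    (Ω : Set (Rn d)) (κ : Rn d → ℝ) (u v : Rn d → F) : ℝ :=
  ∫ x in Ω, κ x * ⟪u x, v x⟫

/-- `w ∈ H¹(Ω)` is a weak solution of the Neumann problem
`-∇·[a(φ)∇w] = μ c(φ) w` in `Ω`, `∂w/∂ν = 0` on `∂Ω`, i.e.
`(∇w, ∇η)_{a(φ)} = μ (w, η)_{c(φ)}` for all `η ∈ H¹(Ω)`. -/
def IsWeakNeumannSolution (Ω : Set (Rn d)) (a c : ℝ → ℝ) (φ : LInf Ω) (μ : ℝ) (w : H1 Ω) : Prop :=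
  ∀ η : H1 Ω, wform Ω (fun x => a (φ x)) (gradH1 w) (gradH1 η)
    = μ * wform Ω (fun x => c (φ x)) (valH1 w) (valH1 η)

/-- `w` is an eigenfunction to the Neumann eigenvalue `μ`. -/
def IsEigenfunction (Ω : Set (Rn d)) (a c : ℝ → ℝ) (φ : LInf Ω) (μ : ℝ) (w : H1 Ω) : Prop :=
  w ≠ 0 ∧ IsWeakNeumannSolution Ω a c φ μ w

/-- The `k`-th Neumann eigenvalue `μ_k^φ`, `k = 0, 1, 2, …`, where the eigenvalues are listed in
increasing order and repeated according to their multiplicity: the smallest `t` such that there are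
`k + 1` linearly independent eigenfunctions to eigenvalues that are at most `t`. -/
def neumannEigenvalue (Ω : Set (Rn d)) (a c : ℝ → ℝ) (φ : LInf Ω) (k : ℕ) : ℝ :=
  sInf {t : ℝ | ∃ w : Fin (k + 1) → H1 Ω, LinearIndependent ℝ w ∧
    ∀ n, ∃ s ≤ t, IsEigenfunction Ω a c φ s (w n)}

/-- `μ` is a simple Neumann eigenvalue: its eigenspace is one-dimensional. -/
def IsSimpleEigenvalue (Ω : Set (Rn d)) (a c : ℝ → ℝ) (φ : LInf Ω) (μ : ℝ) : Prop :=
  ∃ w : H1 Ω, IsEigenfunction Ω a c φ μ w ∧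
    ∀ v : H1 Ω, IsWeakNeumannSolution Ω a c φ μ v → ∃ ξ : ℝ, v = ξ • w

/-- The space `H¹_{(0),φ}(Ω)` of all `w ∈ H¹(Ω)` with `∫_Ω c(φ) w dx = 0`. -/
def H1Mean (Ω : Set (Rn d)) (c : ℝ → ℝ) (φ : LInf Ω) : Set (H1 Ω) :=
  {w | ∫ x in Ω, c (φ x) * valH1 w x = 0}

/-- `w ∈ H¹_{(0),φ}(Ω)` is an eigenfunction to `μ` with `(w, w)_{c(φ)} = 1`. -/
structure IsNormalizedEigenfunction (Ω : Set (Rn d)) (a c : ℝ → ℝ) (φ : LInf Ω) (μ : ℝ)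
    (w : H1 Ω) : Prop where
  mem_H1Mean : w ∈ H1Mean Ω c φ
  isEigenfunction : IsEigenfunction Ω a c φ μ w
  normalized : wform Ω (fun x => c (φ x)) (valH1 w) (valH1 w) = 1

/-- The set `Ω̃ = Ω \ (S₀ ∪ S₁)` on which the phase-field is free. -/
def freeRegion (Ω S₀ S₁ : Set (Rn d)) : Set (Rn d) := Ω \ (S₀ ∪ S₁)

/-- The constraint set `𝒰`: `φ = -1` a.e. on `S₀` and `φ = 1` a.e. on `S₁`. -/
def constraintU (Ω S₀ S₁ : Set (Rn d)) : Set (LInf Ω) :=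
  {φ | (∀ᵐ x ∂(volume.restrict S₀), φ x = -1) ∧ (∀ᵐ x ∂(volume.restrict S₁), φ x = 1)}

/-- The constraint set `𝒢^β`: `φ ∈ H¹(Ω̃)`, `|φ| ≤ 1` a.e. on `Ω̃`, and
`β₁ |Ω̃| ≤ ∫_Ω̃ φ dx ≤ β₂ |Ω̃|`. -/
def constraintG (Ω S₀ S₁ : Set (Rn d)) (β₁ β₂ : ℝ) : Set (LInf Ω) :=
  {φ | MemH1 (freeRegion Ω S₀ S₁) φ ∧
    (∀ᵐ x ∂(volume.restrict (freeRegion Ω S₀ S₁)), |φ x| ≤ 1) ∧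
    β₁ * volume.real (freeRegion Ω S₀ S₁) ≤ ∫ x in freeRegion Ω S₀ S₁, φ x ∧
    ∫ x in freeRegion Ω S₀ S₁, φ x ≤ β₂ * volume.real (freeRegion Ω S₀ S₁)}

/-- The admissible phase-fields `𝒢^β ∩ 𝒰`; they all lie in `L^∞(Ω)`, as `|φ| ≤ 1` a.e. -/
def admissible (Ω S₀ S₁ : Set (Rn d)) (β₁ β₂ : ℝ) : Set (LInf Ω) :=
  constraintG Ω S₀ S₁ β₁ β₂ ∩ constraintU Ω S₀ S₁

/-- The regular part `E^ε` of the Ginzburg–Landau energy. -/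
def energy (Ω S₀ S₁ : Set (Rn d)) (ε : ℝ) (ψ₀ : ℝ → ℝ) (φ : LInf Ω) : ℝ :=
  ∫ x in freeRegion Ω S₀ S₁,
    (ε / 2 * ‖weakGrad (freeRegion Ω S₀ S₁) φ x‖ ^ 2 + 1 / ε * ψ₀ (φ x))

/-- The vector `(μ_{i_1}^φ, …, μ_{i_l}^φ)`. -/
def eigenvalueVector (Ω : Set (Rn d)) (a c : ℝ → ℝ) {l : ℕ} (i : Fin l → ℕ) (φ : LInf Ω) :
    Fin l → ℝ :=
  fun j => neumannEigenvalue Ω a c φ (i j)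

/-- The cost functional `J(φ) = Ψ(μ_{i_1}^φ, …, μ_{i_l}^φ) + γ E^ε(φ)`. -/
def cost (Ω S₀ S₁ : Set (Rn d)) (ε γ : ℝ) (a c ψ₀ : ℝ → ℝ) {l : ℕ} (i : Fin l → ℕ)
    (Ψ : (Fin l → ℝ) → ℝ) (φ : LInf Ω) : ℝ :=
  Ψ (eigenvalueVector Ω a c i φ) + γ * energy Ω S₀ S₁ ε ψ₀ φ

/-- `φ` is admissible and minimises `J` among the admissible phase-fields in some `L^∞(Ω)`-ball
around it. -/
def IsLocalMinimizer (Ω S₀ S₁ : Set (Rn d)) (β₁ β₂ : ℝ) (J : LInf Ω → ℝ) (φ : LInf Ω) : Prop :=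
  φ ∈ admissible Ω S₀ S₁ β₁ β₂ ∧
    ∃ δ : ℝ, 0 < δ ∧ ∀ ϑ ∈ admissible Ω S₀ S₁ β₁ β₂, ‖ϑ - φ‖ < δ → J φ ≤ J ϑ

end PhaseFieldNeumann

end

open PhaseFieldNeumann

/-! The admissible set is convex, so from a local minimizer `φ` every segment towards an admissible
`ϑ` gives one-sided difference quotients of the cost that are eventually nonnegative. The
variational inequality is the limit of these quotients; what has to be proved is that the limit
exists and has the stated form. The energy is a quadratic Dirichlet term plus a smooth superposition
operator, so the real work is the directional derivative of a simple Neumann eigenvalue.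

The eigenvalue problem is treated abstractly as `A w = s C w` for a pair of symmetric forms with `A
+ C` coercive and `C` bounded in a weaker norm for which bounded sequences are precompact.
Minimising Rayleigh quotients on successive `C`-orthogonal complements gives an eigensystem
(`IsFormPair.exists_eigenSystem`), and the min-max principle makes eigenvalues continuous under
relatively small perturbations (`IsFormPair.tendsto_formEigenvalue`). Perturbed eigenvectors
converge along subsequences to eigenvectors of the limit pair; when the eigenvalue is simple the
limit is a multiple of `w`. Testing the perturbed equation with `w`, the limit equation with the
perturbed eigenvector, and subtracting, yields the derivative `A' w w - μ C' w w`
(`IsFormPair.tendsto_slope_formEigenvalue`).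

The compactness needed is Rellich's theorem on Lipschitz domains (`seqCompactMap_valL`). It is
proved from the cone property, without extension operators: averaging test functions over small
shifts into the cone costs a small multiple of the gradient norm, while the averaged pairing
involves only local integrals, which converge under weak convergence.

Positivity of the selected eigenvalues comes from simplicity: a zero eigenvalue of positive index
would have two independent eigenvectors. Testing with constants then gives the mean value condition.
-/

namespace PhaseFieldNeumann

/-! ### Spectral theory and perturbation of pairs of quadratic forms. -/

section FormSpectrum

open Filter
open LinearMap (BilinForm)

variable {H E : Type*} [NormedAddCommGroup H] [InnerProductSpace ℝ H]
  [NormedAddCommGroup E] [NormedSpace ℝ E]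

/-- Bounded sequences have subsequences whose images converge (in the completion). -/
def SeqCompactMap (ι : H →L[ℝ] E) : Prop :=
  ∀ u : ℕ → H, (∃ M, ∀ n, ‖u n‖ ≤ M) →
    ∃ σ : ℕ → ℕ, StrictMono σ ∧ CauchySeq fun n => ι (u (σ n))

/-- Symmetric forms `A ≥ 0` and `C > 0` whose sum is coercive, `A` being bounded on `H` and `C`
bounded with respect to the weaker norm `‖ι ·‖`. -/
structure IsFormPair (ι : H →L[ℝ] E) (A C : BilinForm ℝ H) : Prop where
  symm_left : ∀ u v, A u v = A v u
  symm_right : ∀ u v, C u v = C v u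
  nonneg : ∀ u, 0 ≤ A u u
  pos : ∀ u, u ≠ 0 → 0 < C u u
  bound_left : ∃ K, ∀ u v, |A u v| ≤ K * ‖u‖ * ‖v‖
  bound_right : ∃ K, 0 ≤ K ∧ ∀ u v, |C u v| ≤ K * ‖ι u‖ * ‖ι v‖
  coercive : ∃ α, 0 < α ∧ ∀ u, α * ‖u‖ ^ 2 ≤ A u u + C u u

theorem tendsto_form {B : BilinForm ℝ H} (hB : ∃ K, ∀ u v, |B u v| ≤ K * ‖u‖ * ‖v‖)
    {X : Type*} {l : Filter X} {u v : X → H} {u₀ v₀ : H} (hu : Tendsto u l (𝓝 u₀))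
    (hv : Tendsto v l (𝓝 v₀)) : Tendsto (fun n => B (u n) (v n)) l (𝓝 (B u₀ v₀)) := by
  obtain ⟨K, hK⟩ := hB
  let f := LinearMap.mkContinuous₂ B K hK
  exact (f.continuous₂.tendsto (u₀, v₀)).comp (hu.prodMk_nhds hv)

theorem IsFormPair.bound_right' {ι : H →L[ℝ] E} {A C : BilinForm ℝ H} (h : IsFormPair ι A C) :
    ∃ K, 0 ≤ K ∧ ∀ u v, |C u v| ≤ K * ‖u‖ * ‖v‖ := by
  obtain ⟨K, hK0, hK⟩ := h.bound_right
  refine ⟨K * ‖ι‖ * ‖ι‖, by positivity, fun u v => (hK u v).trans ?_⟩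
  calc K * ‖ι u‖ * ‖ι v‖ ≤ K * (‖ι‖ * ‖u‖) * (‖ι‖ * ‖v‖) := by
        gcongr <;> exact ι.le_opNorm _
    _ = _ := by ring

theorem IsFormPair.bound_right_weak {ι : H →L[ℝ] E} {A C : BilinForm ℝ H}
    (h : IsFormPair ι A C) : ∃ K, ∀ u v, |C u v| ≤ K * ‖u‖ * ‖v‖ :=
  let ⟨K, _, hK⟩ := h.bound_right'
  ⟨K, hK⟩

/-- Coercivity produces estimates of exactly this type, so subsequences that are Cauchy in the weak
norm become Cauchy in `H`. Strong limits are thus available without weak lower semicontinuity. -/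
theorem cauchySeq_of_sq_le {ι : H →L[ℝ] E} {u : ℕ → H} {e : ℕ → ℝ} {b : ℝ} (hb : 0 ≤ b)
    (he : Tendsto e atTop (𝓝 0)) (hu : CauchySeq fun n => ι (u n))
    (h : ∀ n m, ‖u n - u m‖ ^ 2 ≤ e n + e m + b * ‖ι (u n) - ι (u m)‖ ^ 2) : CauchySeq u := by
  rw [Metric.cauchySeq_iff] at hu ⊢
  intro ε hε
  -- Each of the three terms on the right is at most `ε² / 4`; for the last one this uses `b / (b +
  -- 1)² ≤ 1`.
  obtain ⟨N₁, hN₁⟩ := hu (ε / (2 * (b + 1))) (by positivity)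
  obtain ⟨N₂, hN₂⟩ := eventually_atTop.1 (he.eventually_lt_const (show 0 < ε ^ 2 / 4 by positivity))
  refine ⟨max N₁ N₂, fun n hn m hm => ?_⟩
  have h1 := hN₁ n (le_of_max_le_left hn) m (le_of_max_le_left hm)
  rw [dist_eq_norm] at h1 ⊢
  have h2 := hN₂ n (le_of_max_le_right hn)
  have h3 := hN₂ m (le_of_max_le_right hm)
  have h4 : b * ‖ι (u n) - ι (u m)‖ ^ 2 ≤ ε ^ 2 / 4 := by
    have h5 : ‖ι (u n) - ι (u m)‖ ^ 2 ≤ (ε / (2 * (b + 1))) ^ 2 := by gcongr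
    calc b * ‖ι (u n) - ι (u m)‖ ^ 2 ≤ b * (ε / (2 * (b + 1))) ^ 2 := by gcongr
      _ = ε ^ 2 / 4 * (b / (b + 1) ^ 2) := by field_simp; ring
      _ ≤ ε ^ 2 / 4 * 1 := by
        gcongr
        rw [div_le_one (by positivity)]
        nlinarith
      _ = _ := mul_one _
  have h6 := h n m
  exact lt_of_pow_lt_pow_left₀ 2 hε.le (by nlinarith [sq_nonneg ε, pow_pos hε 2])

/-- A null vector minimises a nonnegative form, so the first variation vanishes there. This turns a
minimality property into an Euler–Lagrange equation. -/
theorem form_eq_zero_of_nonneg {B : BilinForm ℝ H} (hsymm : ∀ u v, B u v = B v u)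
    {V : Submodule ℝ H} (hB : ∀ v ∈ V, 0 ≤ B v v) {w : H} (hw : w ∈ V) (h0 : B w w = 0) {η : H}
    (hη : η ∈ V) : B w η = 0 := by
  by_contra hb
  -- Since `B w w = 0`, the form is affine in the coefficient of `w`; this coefficient makes its
  -- value `-1`.
  have h1 := hB _ (V.add_mem (V.smul_mem (-(B η η + 1) / (2 * B w η)) hw) hη)
  simp only [map_add, map_smul, LinearMap.add_apply, LinearMap.smul_apply, smul_eq_mul, h0,
    hsymm η w] at h1
  have h2 : -(B η η + 1) / (2 * B w η) * B w η = -(B η η + 1) / 2 := by field_simp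
  nlinarith

theorem form_sub_self {B : BilinForm ℝ H} (hsymm : ∀ u v, B u v = B v u) (u v : H) :
    B (u - v) (u - v) = 2 * B u u + 2 * B v v - B (u + v) (u + v) := by
  simp only [map_add, map_sub, LinearMap.add_apply, LinearMap.sub_apply, hsymm v u]
  ring

/-- Direct method for the Rayleigh quotient with infimum `m`. For a normalised minimising sequence,
the parallelogram identity and `A ≥ m C` at the sums bound `A` of a difference by the two excesses
over `m` plus `m` times `C` of the difference. Coercivity and compactness then make a subsequence
Cauchy in `H`. -/
theorem IsFormPair.exists_minimizer [CompleteSpace H] {ι : H →L[ℝ] E} {A C : BilinForm ℝ H}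
    (h : IsFormPair ι A C) (hι : SeqCompactMap ι) {V : Submodule ℝ H} (hV : IsClosed (V : Set H))
    (hne : ∃ v ∈ V, v ≠ 0) :
    ∃ w ∈ V, C w w = 1 ∧ ∀ v ∈ V, A w w * C v v ≤ A v v := by
  obtain ⟨K, hK0, hK⟩ := h.bound_right
  obtain ⟨α, hα, hco⟩ := h.coercive
  have hscale : ∀ v ∈ V, v ≠ 0 → ∃ w ∈ V, C w w = 1 ∧ A w w = A v v / C v v := by
    intro v hv hv0
    have hp := h.pos v hv0
    have hs : √(C v v) ≠ 0 := (Real.sqrt_pos.2 hp).ne'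
    have hss : √(C v v) * √(C v v) = C v v := Real.mul_self_sqrt hp.le
    refine ⟨(√(C v v))⁻¹ • v, V.smul_mem _ hv, ?_, ?_⟩
    · simp only [map_smul, LinearMap.smul_apply, smul_eq_mul]
      rw [← mul_assoc, ← mul_inv, hss, inv_mul_cancel₀ hp.ne']
    · simp only [map_smul, LinearMap.smul_apply, smul_eq_mul]
      rw [← mul_assoc, ← mul_inv, hss]
      ring
  set S : Set ℝ := {r | ∃ v ∈ V, C v v = 1 ∧ A v v = r} with hS
  have hSne : S.Nonempty := by
    obtain ⟨v, hv, hv0⟩ := hne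
    obtain ⟨w, hw, hw1, -⟩ := hscale v hv hv0
    exact ⟨_, w, hw, hw1, rfl⟩
  have hSbdd : BddBelow S := ⟨0, by rintro r ⟨v, -, -, rfl⟩; exact h.nonneg v⟩
  set m := sInf S
  have hm0 : 0 ≤ m := le_csInf hSne (by rintro r ⟨v, -, -, rfl⟩; exact h.nonneg v)
  have hm : ∀ v ∈ V, m * C v v ≤ A v v := by
    intro v hv
    rcases eq_or_ne v 0 with rfl | hv0
    · simp
    obtain ⟨w, hw, hw1, hw2⟩ := hscale v hv hv0
    rw [← le_div_iff₀ (h.pos v hv0), ← hw2]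
    exact csInf_le hSbdd ⟨w, hw, hw1, rfl⟩
  obtain ⟨r, -, hrm, hrS⟩ := exists_seq_tendsto_sInf hSne hSbdd
  choose v hvV hv1 hvr using hrS
  have hbdd : ∃ M, ∀ n, ‖v n‖ ≤ M := by
    obtain ⟨R, hR⟩ := hrm.bddAbove_range
    -- `R` bounds the values of `A` along the sequence, and the summand `1` is the value of `C`.
    refine ⟨√((R + 1) / α), fun n => Real.le_sqrt_of_sq_le ?_⟩
    rw [le_div_iff₀ hα, mul_comm]
    refine (hco _).trans ?_
    rw [hv1, hvr]
    gcongr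
    exact hR ⟨n, rfl⟩
  obtain ⟨σ, hσ, hcau⟩ := hι v hbdd
  have hrσ : Tendsto (fun n => r (σ n)) atTop (𝓝 m) := hrm.comp hσ.tendsto_atTop
  have hcv : CauchySeq fun n => v (σ n) := by
    refine cauchySeq_of_sq_le (ι := ι) (e := fun n => 2 / α * (r (σ n) - m))
      (b := (m + 1) * K / α) (by positivity) ?_ hcau fun n p => ?_
    · simpa using (hrσ.sub_const m).const_mul (2 / α)
    · have h1 := form_sub_self h.symm_left (v (σ n)) (v (σ p))
      have h2 := form_sub_self h.symm_right (v (σ n)) (v (σ p))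
      have h3 := hm _ (V.add_mem (hvV (σ n)) (hvV (σ p)))
      have h4 := hco (v (σ n) - v (σ p))
      have h5 := le_of_abs_le (hK (v (σ n) - v (σ p)) (v (σ n) - v (σ p)))
      rw [hvr, hvr] at h1
      rw [hv1, hv1] at h2
      rw [map_sub ι] at h5
      have h6 : (m + 1) * C (v (σ n) - v (σ p)) (v (σ n) - v (σ p)) ≤
          (m + 1) * (K * ‖ι (v (σ n)) - ι (v (σ p))‖ * ‖ι (v (σ n)) - ι (v (σ p))‖) := by gcongr
      have h7 : α * ‖v (σ n) - v (σ p)‖ ^ 2 ≤ 2 * (r (σ n) - m) + 2 * (r (σ p) - m)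
          + (m + 1) * K * ‖ι (v (σ n)) - ι (v (σ p))‖ ^ 2 := by nlinarith
      calc ‖v (σ n) - v (σ p)‖ ^ 2 = α⁻¹ * (α * ‖v (σ n) - v (σ p)‖ ^ 2) := by field_simp
        _ ≤ α⁻¹ * (2 * (r (σ n) - m) + 2 * (r (σ p) - m)
          + (m + 1) * K * ‖ι (v (σ n)) - ι (v (σ p))‖ ^ 2) := by gcongr
        _ = _ := by ring
  obtain ⟨w, hw⟩ := cauchySeq_tendsto_of_complete hcv
  have hA : A w w = m := by
    refine tendsto_nhds_unique (tendsto_form h.bound_left hw hw) ?_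
    simpa only [hvr] using hrσ
  refine ⟨w, hV.mem_of_tendsto hw (.of_forall fun n => hvV _), ?_, fun v hv => hA ▸ hm v hv⟩
  refine tendsto_nhds_unique (tendsto_form h.bound_right_weak hw hw) ?_
  simp only [hv1, tendsto_const_nhds]

/-- A `C`-orthonormal family of eigenvectors, with the variational characterisation of the
eigenvalues. -/
structure IsEigenSystem (A C : BilinForm ℝ H) {k : ℕ} (w : Fin k → H) (s : Fin k → ℝ) : Prop where
  orthonormal : ∀ m n, C (w m) (w n) = if m = n then 1 else 0
  eigen : ∀ n η, A (w n) η = s n * C (w n) η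
  le : ∀ n v, (∀ m < n, C (w m) v = 0) → s n * C v v ≤ A v v

/-- Induction: minimise the Rayleigh quotient on the `C`-orthogonal complement of the eigenvectors
already found. This complement is closed, and nonzero because `H` is infinite-dimensional. -/
theorem IsFormPair.exists_eigenSystem [CompleteSpace H] {ι : H →L[ℝ] E} {A C : BilinForm ℝ H}
    (h : IsFormPair ι A C) (hι : SeqCompactMap ι) (hinf : ¬ FiniteDimensional ℝ H) (k : ℕ) :
    ∃ (w : Fin k → H) (s : Fin k → ℝ), IsEigenSystem A C w s := by
  induction k with
  | zero => exact ⟨Fin.elim0, Fin.elim0, ⟨fun m => m.elim0, fun m => m.elim0, fun m => m.elim0⟩⟩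
  | succ k ih =>
    obtain ⟨w, s, hw⟩ := ih
    let F : H →ₗ[ℝ] (Fin k → ℝ) := LinearMap.pi fun n => C (w n)
    have hF : ∀ v, v ∈ LinearMap.ker F ↔ ∀ n, C (w n) v = 0 := fun v => by
      simp [F, LinearMap.mem_ker, funext_iff]
    have hcl : IsClosed (LinearMap.ker F : Set H) := by
      have : (LinearMap.ker F : Set H) = ⋂ n, {v | C (w n) v = 0} := by
        ext v; simp only [SetLike.mem_coe, hF, mem_iInter, mem_ofPred_eq]
      rw [this]
      refine isClosed_iInter fun n => isClosed_eq ?_ continuous_const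
      exact continuous_iff_continuousAt.2 fun v =>
        tendsto_form h.bound_right_weak tendsto_const_nhds tendsto_id
    have hne : ∃ v ∈ LinearMap.ker F, v ≠ 0 := by
      by_contra! hcon
      exact hinf (FiniteDimensional.of_injective F
        (LinearMap.ker_eq_bot.1 ((Submodule.eq_bot_iff _).2 hcon)))
    obtain ⟨z, hzV, hz1, hz⟩ := h.exists_minimizer hι hcl hne
    have hzw := (hF z).1 hzV
    have hzeig : ∀ η ∈ LinearMap.ker F, A z η = A z z * C z η := by
      intro η hη
      have := form_eq_zero_of_nonneg (B := A - A z z • C) (V := LinearMap.ker F) (w := z)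
        (fun u v => by simp [h.symm_left u v, h.symm_right u v])
        (fun v hv => by simpa using hz v hv) hzV (by simp [hz1]) hη
      simpa [sub_eq_zero] using this
    refine ⟨Fin.snoc w z, Fin.snoc s (A z z), ⟨?_, ?_, ?_⟩⟩
    · intro m n
      refine Fin.lastCases ?_ (fun m => ?_) m <;> refine Fin.lastCases ?_ (fun n => ?_) n
      · simpa using hz1
      · simp [h.symm_right z, hzw, (Fin.castSucc_lt_last n).ne']
      · simp [hzw, (Fin.castSucc_lt_last m).ne]
      · simp [hw.orthonormal]
    · intro n
      refine Fin.lastCases ?_ (fun n => ?_) n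
      · intro η
        simp only [Fin.snoc_last]
        -- So far the eigenvalue equation holds only against the complement. The removed part of `η`
        -- lies in the span of earlier eigenvectors, to which `z` is both `C`- and `A`-orthogonal,
        -- so the equation extends to all `η`.
        let p := η - ∑ n, C (w n) η • w n
        have hp : p ∈ LinearMap.ker F := by
          rw [hF]; intro n
          simp [p, hw.orthonormal]
        have e1 : A z p = A z η := by
          simp [p, h.symm_left z, hw.eigen, hzw]
        have e2 : C z p = C z η := by
          simp [p, h.symm_right z, hzw]
        rw [← e1, ← e2, hzeig p hp]
      · intro η
        simpa using hw.eigen n η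
    · intro n
      refine Fin.lastCases ?_ (fun n => ?_) n
      · intro v hv
        simp only [Fin.snoc_last]
        refine hz v ((hF v).2 fun n => ?_)
        simpa using hv n.castSucc (Fin.castSucc_lt_last n)
      · intro v hv
        simp only [Fin.snoc_castSucc]
        refine hw.le n v fun m hm => ?_
        simpa using hv m.castSucc (by simpa using hm)

/-- The `k`-th eigenvalue of `A w = s C w`, counted with multiplicity. -/
noncomputable def formEigenvalue (A C : BilinForm ℝ H) (k : ℕ) : ℝ :=
  sInf {t : ℝ | ∃ w : Fin (k + 1) → H, LinearIndependent ℝ w ∧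
    ∀ n, ∃ s ≤ t, w n ≠ 0 ∧ ∀ η, A (w n) η = s * C (w n) η}

theorem IsEigenSystem.linearIndependent {A C : BilinForm ℝ H} {k : ℕ} {w : Fin k → H}
    {s : Fin k → ℝ} (hw : IsEigenSystem A C w s) : LinearIndependent ℝ w := by
  rw [Fintype.linearIndependent_iff]
  intro x hx n
  have := congrArg (C (w n)) hx
  simpa [hw.orthonormal] using this

theorem IsEigenSystem.monotone {A C : BilinForm ℝ H} {k : ℕ} {w : Fin k → H}
    {s : Fin k → ℝ} (hw : IsEigenSystem A C w s) : Monotone s := by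
  intro m n hmn
  have h1 := hw.le m (w n) fun p hp => by
    rw [hw.orthonormal, if_neg (hp.trans_le hmn).ne]
  simpa [hw.eigen, hw.orthonormal] using h1

/-- If `t` were below the last `s`, every eigenvector with eigenvalue at most `t` would lie in the
span of the first `k` vectors: the remainder after `C`-projection has Rayleigh quotient `r ≤ t` but,
by orthogonality, at least the last `s`, unless it is zero. A span of dimension at most `k` cannot
contain `k + 1` independent vectors. -/
theorem IsEigenSystem.formEigenvalue_eq {ι : H →L[ℝ] E} {A C : BilinForm ℝ H}
    (h : IsFormPair ι A C) {k : ℕ} {w : Fin (k + 1) → H} {s : Fin (k + 1) → ℝ}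
    (hw : IsEigenSystem A C w s) : formEigenvalue A C k = s (Fin.last k) := by
  refine IsLeast.csInf_eq ⟨⟨w, hw.linearIndependent, fun n =>
    ⟨s n, hw.monotone (Fin.le_last n), hw.linearIndependent.ne_zero n, hw.eigen n⟩⟩, ?_⟩
  rintro t ⟨u, hu, hut⟩
  by_contra! hlt
  let W := Submodule.span ℝ (range fun n : Fin k => w n.castSucc)
  have hmem : ∀ n, u n ∈ W := by
    intro n
    obtain ⟨r, hrt, -, hr⟩ := hut n
    let q := ∑ m : Fin k, C (w m.castSucc) (u n) • w m.castSucc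
    have hq : q ∈ W := W.sum_mem fun m _ => W.smul_mem _ (Submodule.subset_span ⟨m, rfl⟩)
    have horth : ∀ m : Fin k, C (w m.castSucc) (u n - q) = 0 := by
      intro m
      simp [q, hw.orthonormal]
    have hAq : A q (u n - q) = 0 := by
      simp only [q, map_sum, LinearMap.sum_apply, map_smul, LinearMap.smul_apply]
      exact Finset.sum_eq_zero fun m _ => by rw [hw.eigen, horth]; simp
    have hCq : C q (u n - q) = 0 := by
      simp only [q, map_sum, LinearMap.sum_apply, map_smul, LinearMap.smul_apply]
      exact Finset.sum_eq_zero fun m _ => by rw [horth]; simp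
    have h1 : A (u n - q) (u n - q) = r * C (u n - q) (u n - q) := by
      rw [map_sub A, map_sub C, LinearMap.sub_apply, LinearMap.sub_apply, hAq, hCq, hr]
      ring
    have h2 := hw.le (Fin.last k) (u n - q) fun m hm => by
      simpa using horth (m.castPred hm.ne)
    have h3 : u n - q = 0 := by
      by_contra h0
      nlinarith [h.pos _ h0]
    rw [sub_eq_zero.1 h3]
    exact hq
  have h1 : Module.finrank ℝ (Submodule.span ℝ (range u)) = k + 1 := by
    simpa using finrank_span_eq_card hu
  have h2 : Module.finrank ℝ W ≤ k := by
    simpa [Set.finrank] using finrank_range_le_card (R := ℝ) fun n : Fin k => w n.castSucc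
  have h3 : Submodule.span ℝ (range u) ≤ W :=
    Submodule.span_le.2 (by rintro _ ⟨n, rfl⟩; exact hmem n)
  have : FiniteDimensional ℝ W := FiniteDimensional.span_of_finite ℝ (finite_range _)
  have h4 := Submodule.finrank_mono h3
  omega

/-- Upper half of the min-max principle: a `(k + 1)`-dimensional space contains a nonzero vector
that is `C`-orthogonal to the first `k` eigenvectors, and its Rayleigh quotient is at least the
`k`-th eigenvalue. -/
theorem IsFormPair.formEigenvalue_le [CompleteSpace H] {ι : H →L[ℝ] E} {A C : BilinForm ℝ H}
    (h : IsFormPair ι A C) (hι : SeqCompactMap ι) (hinf : ¬ FiniteDimensional ℝ H) {k : ℕ}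
    {u : Fin (k + 1) → H} (hu : LinearIndependent ℝ u) {t : ℝ}
    (ht : ∀ v ∈ Submodule.span ℝ (range u), A v v ≤ t * C v v) : formEigenvalue A C k ≤ t := by
  obtain ⟨w, s, hw⟩ := h.exists_eigenSystem hι hinf (k + 1)
  rw [hw.formEigenvalue_eq h]
  let F : (Fin (k + 1) → ℝ) →ₗ[ℝ] (Fin k → ℝ) :=
    (LinearMap.pi fun n : Fin k => C (w n.castSucc)) ∘ₗ Fintype.linearCombination ℝ u
  have hF : LinearMap.ker F ≠ ⊥ := LinearMap.ker_ne_bot_of_finrank_lt (by simp)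
  obtain ⟨x, hx, hx0⟩ := (Submodule.ne_bot_iff _).1 hF
  set v := Fintype.linearCombination ℝ u x with hv
  have hv0 : v ≠ 0 := fun h0 => hx0 <| funext fun n => by
    rw [hv, Fintype.linearCombination_apply] at h0
    exact Fintype.linearIndependent_iff.1 hu x h0 n
  have hvs : v ∈ Submodule.span ℝ (range u) := by
    rw [← Fintype.range_linearCombination]
    exact ⟨x, rfl⟩
  have h1 := hw.le (Fin.last k) v fun m hm => by
    have h0 : C (w (m.castPred hm.ne).castSucc) v = 0 :=
      congrFun (LinearMap.mem_ker.1 hx) (m.castPred hm.ne)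
    simpa using h0
  exact le_of_mul_le_mul_right (h1.trans (ht v hvs)) (h.pos v hv0)

theorem IsEigenSystem.le_on_span {A C : BilinForm ℝ H} {k : ℕ} {w : Fin (k + 1) → H}
    {s : Fin (k + 1) → ℝ} (hw : IsEigenSystem A C w s) {v : H}
    (hv : v ∈ Submodule.span ℝ (range w)) : A v v ≤ s (Fin.last k) * C v v := by
  rw [← Fintype.range_linearCombination] at hv
  obtain ⟨x, rfl⟩ := hv
  simp only [Fintype.linearCombination_apply, map_sum, LinearMap.sum_apply, map_smul,
    LinearMap.smul_apply, hw.eigen, hw.orthonormal, smul_eq_mul, Finset.mul_sum]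
  refine Finset.sum_le_sum fun m _ => ?_
  simp only [mul_ite, mul_one, mul_zero, Finset.sum_ite_eq', Finset.mem_univ,
    if_true]
  have := hw.monotone (Fin.le_last m)
  nlinarith [mul_self_nonneg (x m)]

theorem IsFormPair.formEigenvalue_nonneg [CompleteSpace H] {ι : H →L[ℝ] E} {A C : BilinForm ℝ H}
    (h : IsFormPair ι A C) (hι : SeqCompactMap ι) (hinf : ¬ FiniteDimensional ℝ H) (k : ℕ) :
    0 ≤ formEigenvalue A C k := by
  obtain ⟨w, s, hw⟩ := h.exists_eigenSystem hι hinf (k + 1)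
  rw [hw.formEigenvalue_eq h]
  simpa [hw.eigen, hw.orthonormal] using h.nonneg (w (Fin.last k))

theorem IsFormPair.exists_eigenvector [CompleteSpace H] {ι : H →L[ℝ] E} {A C : BilinForm ℝ H}
    (h : IsFormPair ι A C) (hι : SeqCompactMap ι) (hinf : ¬ FiniteDimensional ℝ H) (k : ℕ) :
    ∃ w, ‖w‖ = 1 ∧ ∀ η, A w η = formEigenvalue A C k * C w η := by
  obtain ⟨w, s, hw⟩ := h.exists_eigenSystem hι hinf (k + 1)
  rw [hw.formEigenvalue_eq h]
  have h0 := hw.linearIndependent.ne_zero (Fin.last k)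
  refine ⟨‖w (Fin.last k)‖⁻¹ • w (Fin.last k), norm_smul_inv_norm h0, fun η => ?_⟩
  simp [hw.eigen]
  ring

/-- A simple eigenvalue with positive index is positive. -/
theorem IsFormPair.formEigenvalue_pos [CompleteSpace H] {ι : H →L[ℝ] E} {A C : BilinForm ℝ H}
    (h : IsFormPair ι A C) (hι : SeqCompactMap ι) (hinf : ¬ FiniteDimensional ℝ H) {k : ℕ}
    (hk : 0 < k) {w₀ : H}
    (hsimple : ∀ v, (∀ η, A v η = formEigenvalue A C k * C v η) → ∃ ξ : ℝ, v = ξ • w₀) :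
    0 < formEigenvalue A C k := by
  refine lt_of_le_of_ne (h.formEigenvalue_nonneg hι hinf k) fun h0 => ?_
  -- If the `k`-th eigenvalue were zero, monotonicity would make all earlier ones zero. Members `0`
  -- and `k` would then be `C`-orthonormal vectors on the line through `w₀`, which is impossible.
  obtain ⟨w, s, hw⟩ := h.exists_eigenSystem hι hinf (k + 1)
  have hs0 : s (Fin.last k) = 0 := by rw [← hw.formEigenvalue_eq h, ← h0]
  have hs : ∀ n, s n = 0 := fun n =>
    le_antisymm (hs0 ▸ hw.monotone (Fin.le_last n))
      (by simpa [hw.eigen, hw.orthonormal] using h.nonneg (w n))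
  have hξ : ∀ n, ∃ ξ : ℝ, w n = ξ • w₀ := fun n => hsimple _ fun η => by
    rw [hw.eigen, hs, ← h0]
  obtain ⟨ξ, hξ0⟩ := hξ 0
  obtain ⟨ξ', hξ1⟩ := hξ (Fin.last k)
  have hne : (0 : Fin (k + 1)) ≠ Fin.last k := by
    simp [Fin.ext_iff]; omega
  have e1 := hw.orthonormal 0 0
  have e2 := hw.orthonormal (Fin.last k) (Fin.last k)
  have e3 := hw.orthonormal 0 (Fin.last k)
  rw [hξ0] at e1 e3
  rw [hξ1] at e2 e3
  simp only [map_smul, LinearMap.smul_apply, smul_eq_mul, if_true, if_neg hne] at e1 e2 e3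
  have : (ξ * (ξ * C w₀ w₀)) * (ξ' * (ξ' * C w₀ w₀)) = (ξ * (ξ' * C w₀ w₀)) ^ 2 := by ring
  rw [e1, e2, show ξ * (ξ' * C w₀ w₀) = 0 by linarith] at this
  norm_num at this

/-- The span of the first `k + 1` eigenvectors of `(A, C)` serves as trial space for `(A', C')`. -/
theorem IsFormPair.formEigenvalue_le_mul [CompleteSpace H] {ι : H →L[ℝ] E}
    {A C A' C' : BilinForm ℝ H} (h : IsFormPair ι A C) (h' : IsFormPair ι A' C')
    (hι : SeqCompactMap ι) (hinf : ¬ FiniteDimensional ℝ H) {p q : ℝ} (hp : 0 ≤ p) (hq : 0 < q)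
    (hA : ∀ v, A' v v ≤ p * A v v) (hC : ∀ v, q * C v v ≤ C' v v) (k : ℕ) :
    formEigenvalue A' C' k ≤ p / q * formEigenvalue A C k := by
  obtain ⟨w, s, hw⟩ := h.exists_eigenSystem hι hinf (k + 1)
  refine h'.formEigenvalue_le hι hinf hw.linearIndependent fun v hv => ?_
  have h1 := hw.le_on_span hv
  rw [← hw.formEigenvalue_eq h] at h1
  have h0 := h.formEigenvalue_nonneg hι hinf k
  calc A' v v ≤ p * A v v := hA v
    _ ≤ p * (formEigenvalue A C k * C v v) := by gcongr
    _ = p / q * formEigenvalue A C k * (q * C v v) := by field_simp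
    _ ≤ p / q * formEigenvalue A C k * C' v v := by gcongr; exact hC v

/-- Relative closeness of the forms allows `formEigenvalue_le_mul` in both directions, which traps
the eigenvalue between the factors `(1 - θ) / (1 + θ)` and `(1 + θ) / (1 - θ)` once `θ < 1`. -/
theorem IsFormPair.tendsto_formEigenvalue [CompleteSpace H] {ι : H →L[ℝ] E}
    {A C : BilinForm ℝ H} {An Cn : ℕ → BilinForm ℝ H} (h : IsFormPair ι A C)
    (hn : ∀ n, IsFormPair ι (An n) (Cn n)) (hι : SeqCompactMap ι)
    (hinf : ¬ FiniteDimensional ℝ H) {θ : ℕ → ℝ} (hθ : Tendsto θ atTop (𝓝 0))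
    (hθ0 : ∀ n, 0 ≤ θ n)
    (hA : ∀ n v, |An n v v - A v v| ≤ θ n * A v v) (hC : ∀ n v, |Cn n v v - C v v| ≤ θ n * C v v)
    (k : ℕ) :
    Tendsto (fun n => formEigenvalue (An n) (Cn n) k) atTop (𝓝 (formEigenvalue A C k)) := by
  have hlt := hθ.eventually_lt_const (show (0 : ℝ) < 1 by norm_num)
  have t1 : Tendsto (fun n => (1 + θ n) / (1 - θ n) * formEigenvalue A C k) atTop
      (𝓝 (formEigenvalue A C k)) := by
    have := ((hθ.const_add 1).div (hθ.const_sub 1) (by norm_num)).mul_const (formEigenvalue A C k)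
    simpa using this
  have t2 : Tendsto (fun n => (1 - θ n) / (1 + θ n) * formEigenvalue A C k) atTop
      (𝓝 (formEigenvalue A C k)) := by
    have := ((hθ.const_sub 1).div (hθ.const_add 1) (by norm_num)).mul_const (formEigenvalue A C k)
    simpa using this
  refine tendsto_of_tendsto_of_tendsto_of_le_of_le' t2 t1 ?_ ?_
  · filter_upwards [hlt] with n hn1
    have hpos : 0 < 1 - θ n := by linarith
    have hpos' : 0 < 1 + θ n := by linarith [hθ0 n]
    have := (hn n).formEigenvalue_le_mul h hι hinf (p := (1 - θ n)⁻¹) (q := (1 + θ n)⁻¹)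
      (by positivity) (by positivity)
      (fun v => by
        rw [← div_eq_inv_mul, le_div_iff₀ hpos]
        linarith [(abs_le.1 (hA n v)).1])
      (fun v => by
        rw [← div_eq_inv_mul, div_le_iff₀ hpos']
        linarith [(abs_le.1 (hC n v)).2]) k
    calc (1 - θ n) / (1 + θ n) * formEigenvalue A C k
        ≤ (1 - θ n) / (1 + θ n) * ((1 - θ n)⁻¹ / (1 + θ n)⁻¹ * formEigenvalue (An n) (Cn n) k) := by
          gcongr
      _ = _ := by field_simp
  · filter_upwards [hlt] with n hn1
    have hpos : 0 < 1 - θ n := by linarith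
    exact h.formEigenvalue_le_mul (hn n) hι hinf (by linarith [hθ0 n]) hpos
      (fun v => by linarith [(abs_le.1 (hA n v)).2])
      (fun v => by linarith [(abs_le.1 (hC n v)).1]) k

/-- Perturbed eigenvectors solve the limit equation up to a small error. Testing the difference of
two such equations with the difference of the eigenvectors and using coercivity gives a Cauchy
subsequence, along which the equation passes to the limit. -/
theorem IsFormPair.exists_subseq_eigenvector [CompleteSpace H] {ι : H →L[ℝ] E}
    {A C : BilinForm ℝ H} {An Cn : ℕ → BilinForm ℝ H} (h : IsFormPair ι A C)
    (hι : SeqCompactMap ι) {θ : ℕ → ℝ} (hθ : Tendsto θ atTop (𝓝 0))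
    (hA : ∀ n u v, |An n u v - A u v| ≤ θ n * ‖u‖ * ‖v‖)
    (hC : ∀ n u v, |Cn n u v - C u v| ≤ θ n * ‖u‖ * ‖v‖)
    {μn : ℕ → ℝ} {μ : ℝ} (hμ : Tendsto μn atTop (𝓝 μ)) {w : ℕ → H} (hw1 : ∀ n, ‖w n‖ = 1)
    (hw : ∀ n η, An n (w n) η = μn n * Cn n (w n) η) :
    ∃ σ : ℕ → ℕ, StrictMono σ ∧ ∃ w₀, ‖w₀‖ = 1 ∧ Tendsto (fun n => w (σ n)) atTop (𝓝 w₀) ∧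
      ∀ η, A w₀ η = μ * C w₀ η := by
  obtain ⟨K, hK0, hK⟩ := h.bound_right
  obtain ⟨K', hK'0, hK'⟩ := h.bound_right'
  obtain ⟨α, hα, hco⟩ := h.coercive
  obtain ⟨σ, hσ, hcau⟩ := hι w ⟨1, fun n => (hw1 n).le⟩
  -- The three contributions are the perturbation of `A`, the perturbation of `C` weighted by the
  -- eigenvalue, and the shift of the eigenvalue.
  set e : ℕ → ℝ := fun n => θ n + |μn n| * θ n + |μn n - μ| * K' with he
  have he0 : Tendsto e atTop (𝓝 0) := by
    have := (hθ.add (hμ.abs.mul hθ)).add ((hμ.sub_const μ).abs.mul_const K')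
    simpa using this
  have herr : ∀ n v, |A (w n) v - μ * C (w n) v| ≤ e n * ‖v‖ := by
    intro n v
    have h1 := hA n (w n) v
    have h2 := hC n (w n) v
    have h3 := hK' (w n) v
    rw [hw1, mul_one] at h1 h2 h3
    have h4 : A (w n) v - μ * C (w n) v = -(An n (w n) v - A (w n) v)
        + μn n * (Cn n (w n) v - C (w n) v) + (μn n - μ) * C (w n) v := by
      rw [hw]; ring
    rw [h4]
    calc _ ≤ |An n (w n) v - A (w n) v| + |μn n| * |Cn n (w n) v - C (w n) v|
          + |μn n - μ| * |C (w n) v| := by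
          refine (abs_add_le _ _).trans ?_
          rw [abs_mul]
          gcongr
          refine (abs_add_le _ _).trans ?_
          rw [abs_mul, abs_neg]
      _ ≤ θ n * ‖v‖ + |μn n| * (θ n * ‖v‖) + |μn n - μ| * (K' * ‖v‖) := by gcongr
      _ = e n * ‖v‖ := by simp only [he]; ring
  have he_nonneg : ∀ n, 0 ≤ e n := fun n => by
    simpa [hw1] using (abs_nonneg _).trans (herr n (w n))
  have hcv : CauchySeq fun n => w (σ n) := by
    refine cauchySeq_of_sq_le (ι := ι) (e := fun n => 2 / α * e (σ n))
      (b := (|μ| + 1) * K / α) (by positivity) ?_ hcau fun n m => ?_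
    · simpa using (he0.comp hσ.tendsto_atTop).const_mul (2 / α)
    · set d := w (σ n) - w (σ m) with hd
      have hd2 : ‖d‖ ≤ 2 := by
        refine (norm_sub_le _ _).trans ?_
        rw [hw1, hw1]; norm_num
      have h1 := (abs_le.1 (herr (σ n) d)).2
      have h2 := (abs_le.1 (herr (σ m) d)).1
      have h3 : A d d = A (w (σ n)) d - A (w (σ m)) d := by
        rw [← LinearMap.sub_apply, ← map_sub]
      have h4 : C d d = C (w (σ n)) d - C (w (σ m)) d := by
        rw [← LinearMap.sub_apply, ← map_sub]
      have h5 := hK d d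
      have h6 := hco d
      have h7 : ι d = ι (w (σ n)) - ι (w (σ m)) := map_sub _ _ _
      rw [h7] at h5
      have h8 : (μ + 1) * C d d ≤
          (|μ| + 1) * (K * ‖ι (w (σ n)) - ι (w (σ m))‖ * ‖ι (w (σ n)) - ι (w (σ m))‖) := by
        calc (μ + 1) * C d d ≤ |(μ + 1) * C d d| := le_abs_self _
          _ ≤ (|μ| + 1) * |C d d| := by
            rw [abs_mul]; gcongr; exact (abs_add_le _ _).trans (by simp)
          _ ≤ _ := by gcongr
      have h9 : e (σ n) * ‖d‖ ≤ e (σ n) * 2 := by gcongr; exact he_nonneg _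
      have h10 : e (σ m) * ‖d‖ ≤ e (σ m) * 2 := by gcongr; exact he_nonneg _
      have h11 : α * ‖d‖ ^ 2 ≤ 2 * e (σ n) + 2 * e (σ m)
          + (|μ| + 1) * K * ‖ι (w (σ n)) - ι (w (σ m))‖ ^ 2 := by
        have h12 : μ * C d d = μ * C (w (σ n)) d - μ * C (w (σ m)) d := by rw [h4]; ring
        linarith
      calc ‖d‖ ^ 2 = α⁻¹ * (α * ‖d‖ ^ 2) := by field_simp
        _ ≤ α⁻¹ * (2 * e (σ n) + 2 * e (σ m)
          + (|μ| + 1) * K * ‖ι (w (σ n)) - ι (w (σ m))‖ ^ 2) := by gcongr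
        _ = _ := by ring
  obtain ⟨w₀, hw₀⟩ := cauchySeq_tendsto_of_complete hcv
  refine ⟨σ, hσ, w₀, ?_, hw₀, fun η => ?_⟩
  · exact tendsto_nhds_unique hw₀.norm (by simp only [hw1, tendsto_const_nhds])
  · have t1 : Tendsto (fun n => A (w (σ n)) η - μ * C (w (σ n)) η) atTop
        (𝓝 (A w₀ η - μ * C w₀ η)) :=
      (tendsto_form h.bound_left hw₀ tendsto_const_nhds).sub
        ((tendsto_form h.bound_right_weak hw₀ tendsto_const_nhds).const_mul μ)
    have t2 : Tendsto (fun n => A (w (σ n)) η - μ * C (w (σ n)) η) atTop (𝓝 0) := by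
      refine squeeze_zero_norm (fun n => herr (σ n) η) ?_
      simpa using (he0.comp hσ.tendsto_atTop).mul_const ‖η‖
    exact sub_eq_zero.1 (tendsto_nhds_unique t1 t2)

/-- Differentiability of simple eigenvalues along a differentiable family of forms. -/
theorem IsFormPair.tendsto_slope_formEigenvalue [CompleteSpace H] {ι : H →L[ℝ] E}
    {A C A' C' : BilinForm ℝ H} {An Cn : ℕ → BilinForm ℝ H} (h : IsFormPair ι A C)
    (hn : ∀ n, IsFormPair ι (An n) (Cn n)) (hι : SeqCompactMap ι)
    (hinf : ¬ FiniteDimensional ℝ H) {θ t : ℕ → ℝ} (hθ : Tendsto θ atTop (𝓝 0))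
    (hθ0 : ∀ n, 0 ≤ θ n) (ht : Tendsto t atTop (𝓝 0)) (ht0 : ∀ n, t n ≠ 0)
    (hA : ∀ n v, |An n v v - A v v| ≤ θ n * A v v) (hC : ∀ n v, |Cn n v v - C v v| ≤ θ n * C v v)
    (hA'b : ∃ K, ∀ u v, |A' u v| ≤ K * ‖u‖ * ‖v‖) (hC'b : ∃ K, ∀ u v, |C' u v| ≤ K * ‖u‖ * ‖v‖)
    (hA' : ∀ n u v, |An n u v - A u v - t n * A' u v| ≤ |t n| * θ n * ‖u‖ * ‖v‖)
    (hC' : ∀ n u v, |Cn n u v - C u v - t n * C' u v| ≤ |t n| * θ n * ‖u‖ * ‖v‖)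
    {k : ℕ} {w : H} (hw : ∀ η, A w η = formEigenvalue A C k * C w η) (hw1 : C w w = 1)
    (hsimple : ∀ v, (∀ η, A v η = formEigenvalue A C k * C v η) → ∃ ξ : ℝ, v = ξ • w) :
    Tendsto (fun n => (t n)⁻¹ * (formEigenvalue (An n) (Cn n) k - formEigenvalue A C k)) atTop
      (𝓝 (A' w w - formEigenvalue A C k * C' w w)) := by
  have hevt := h.tendsto_formEigenvalue hn hι hinf hθ hθ0 hA hC k
  choose z hz1 hz using fun n => (hn n).exists_eigenvector hι hinf k
  obtain ⟨KA, hKA⟩ := hA'b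
  obtain ⟨KC, hKC⟩ := hC'b
  set μ := formEigenvalue A C k with hμ
  set μn : ℕ → ℝ := fun n => formEigenvalue (An n) (Cn n) k with hμn
  -- Size of the zeroth-order perturbation: first-order remainder plus `|t n|` times the bounds of
  -- the derivative forms.
  set θ' : ℕ → ℝ := fun n => |t n| * θ n + |t n| * (|KA| + |KC|) with hθ'
  have hθ'0 : Tendsto θ' atTop (𝓝 0) := by
    have := (ht.abs.mul hθ).add (ht.abs.mul_const (|KA| + |KC|))
    simpa using this
  have hbd : ∀ {B B' : BilinForm ℝ H} {Bn : ℕ → BilinForm ℝ H} {K : ℝ}, |K| ≤ |KA| + |KC| →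
      (∀ u v, |B' u v| ≤ K * ‖u‖ * ‖v‖) →
      (∀ n u v, |Bn n u v - B u v - t n * B' u v| ≤ |t n| * θ n * ‖u‖ * ‖v‖) →
      ∀ n u v, |Bn n u v - B u v| ≤ θ' n * ‖u‖ * ‖v‖ := by
    intro B B' Bn K hK h1 h2 n u v
    calc |Bn n u v - B u v| = |(Bn n u v - B u v - t n * B' u v) + t n * B' u v| := by ring_nf
      _ ≤ |t n| * θ n * ‖u‖ * ‖v‖ + |t n| * (K * ‖u‖ * ‖v‖) := by
        refine (abs_add_le _ _).trans ?_
        rw [abs_mul]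
        gcongr
        · exact h2 n u v
        · exact h1 u v
      _ ≤ |t n| * θ n * ‖u‖ * ‖v‖ + |t n| * ((|KA| + |KC|) * ‖u‖ * ‖v‖) := by
        gcongr
        exact (le_abs_self K).trans hK
      _ = θ' n * ‖u‖ * ‖v‖ := by simp only [hθ']; ring
  have hAbd := hbd (by linarith [abs_nonneg KC]) hKA hA'
  have hCbd := hbd (by linarith [abs_nonneg KA]) hKC hC'
  -- The perturbed eigenvectors are fixed only up to sign and need not converge as a whole. It
  -- suffices that every subsequence has a further one along which the quotient has the claimed
  -- limit, which does not depend on the factor `ξ` below.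
  refine tendsto_of_subseq_tendsto fun ns hns => ?_
  obtain ⟨σ, hσ, w₀, hw₀1, hw₀, heig⟩ := h.exists_subseq_eigenvector (An := fun n => An (ns n))
    (Cn := fun n => Cn (ns n)) hι (hθ'0.comp hns) (fun n => hAbd (ns n)) (fun n => hCbd (ns n))
    (hevt.comp hns) (fun n => hz1 (ns n)) (fun n => hz (ns n))
  refine ⟨σ, ?_⟩
  obtain ⟨ξ, rfl⟩ := hsimple w₀ heig
  have hξ : ξ ≠ 0 := by
    rintro rfl
    simp at hw₀1
  set τ : ℕ → ℕ := fun n => ns (σ n) with hτ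
  have hττ : Tendsto τ atTop atTop := hns.comp hσ.tendsto_atTop
  have hquot : ∀ {B B' : BilinForm ℝ H} {Bn : ℕ → BilinForm ℝ H},
      (∃ K, ∀ u v, |B' u v| ≤ K * ‖u‖ * ‖v‖) →
      (∀ n u v, |Bn n u v - B u v - t n * B' u v| ≤ |t n| * θ n * ‖u‖ * ‖v‖) →
      Tendsto (fun n => (t (τ n))⁻¹ * (Bn (τ n) (z (τ n)) w - B (z (τ n)) w)) atTop
        (𝓝 (B' (ξ • w) w)) := by
    intro B B' Bn h1 h2
    have e1 : Tendsto (fun n => B' (z (τ n)) w) atTop (𝓝 (B' (ξ • w) w)) :=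
      tendsto_form h1 hw₀ tendsto_const_nhds
    have e2 : Tendsto (fun n => (t (τ n))⁻¹ * (Bn (τ n) (z (τ n)) w - B (z (τ n)) w)
        - B' (z (τ n)) w) atTop (𝓝 0) := by
      refine squeeze_zero_norm (a := fun n => θ (τ n) * ‖w‖) (fun n => ?_) ?_
      · have h3 := h2 (τ n) (z (τ n)) w
        have h4 : (t (τ n))⁻¹ * (Bn (τ n) (z (τ n)) w - B (z (τ n)) w) - B' (z (τ n)) w
            = (t (τ n))⁻¹ * (Bn (τ n) (z (τ n)) w - B (z (τ n)) w - t (τ n) * B' (z (τ n)) w) := by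
          have := ht0 (τ n)
          field_simp
        rw [h4, Real.norm_eq_abs, abs_mul, abs_inv, inv_mul_le_iff₀ (abs_pos.2 (ht0 _))]
        rw [hz1, mul_one] at h3
        linarith
      · simpa using (hθ.comp hττ).mul_const ‖w‖
    simpa using e2.add e1
  have hqA := hquot ⟨KA, hKA⟩ hA'
  have hqC := hquot ⟨KC, hKC⟩ hC'
  have hCw : Tendsto (fun n => Cn (τ n) (z (τ n)) w) atTop (𝓝 ξ) := by
    have e1 : Tendsto (fun n => C (z (τ n)) w) atTop (𝓝 (C (ξ • w) w)) :=
      tendsto_form h.bound_right_weak hw₀ tendsto_const_nhds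
    have e2 : Tendsto (fun n => Cn (τ n) (z (τ n)) w - C (z (τ n)) w) atTop (𝓝 0) := by
      refine squeeze_zero_norm (a := fun n => θ' (τ n) * ‖w‖) (fun n => ?_) ?_
      · have := hCbd (τ n) (z (τ n)) w
        rwa [hz1, mul_one] at this
      · simpa using (hθ'0.comp hττ).mul_const ‖w‖
    simpa [hw1] using e2.add e1
  -- Symmetry and the two eigenvalue equations give `(μn - μ) * Cn z w = (An - A) z w - μ * (Cn - C)
  -- z w`. After division by `t n` and by `Cn z w`, which tends to `ξ ≠ 0`, the factor `ξ` cancels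
  -- in the limit.
  have hfin := (hqA.sub (hqC.const_mul μ)).div hCw hξ
  have hlim : (A' (ξ • w) w - μ * C' (ξ • w) w) / ξ = A' w w - μ * C' w w := by
    simp only [map_smul, LinearMap.smul_apply, smul_eq_mul]
    field_simp
  rw [hlim] at hfin
  refine hfin.congr' ?_
  filter_upwards [hCw.eventually_ne hξ] with n hne
  rw [Pi.div_apply, div_eq_iff hne, hz, h.symm_left (z (τ n)) w, hw, h.symm_right w (z (τ n))]
  simp only [hτ]
  ring

end FormSpectrum

/-! ### The Hilbert space `H¹(U)`: completeness, uniqueness of weak gradients, infinite dimension.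
-/

section SobolevBasics

open Filter

variable {d : ℕ}

theorem integral_inner_eq_inner_toLp {X F : Type*} [MeasurableSpace X] {μ : Measure X}
    [NormedAddCommGroup F] [InnerProductSpace ℝ F] (f : Lp F 2 μ) {g : X → F}
    (hg : MemLp g 2 μ) : ∫ x, ⟪f x, g x⟫ ∂μ = ⟪f, hg.toLp g⟫ := by
  rw [L2.inner_def]
  refine integral_congr_ae ?_
  filter_upwards [hg.coeFn_toLp] with x hx
  rw [hx]

theorem sq_norm_eq_integral {X F : Type*} [MeasurableSpace X] {μ : Measure X}
    [NormedAddCommGroup F] [InnerProductSpace ℝ F] (f : Lp F 2 μ) :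
    ‖f‖ ^ 2 = ∫ x, ‖f x‖ ^ 2 ∂μ := by
  rw [← real_inner_self_eq_norm_sq, L2.inner_def]
  simp

theorem sq_norm_toLp_eq_integral {X F : Type*} [MeasurableSpace X] {μ : Measure X}
    [NormedAddCommGroup F] [InnerProductSpace ℝ F] {g : X → F} (hg : MemLp g 2 μ) :
    ‖hg.toLp g‖ ^ 2 = ∫ x, ‖g x‖ ^ 2 ∂μ := by
  rw [sq_norm_eq_integral]
  refine integral_congr_ae ?_
  filter_upwards [hg.coeFn_toLp] with x hx
  rw [hx]

theorem abs_integral_inner_le {X F : Type*} [MeasurableSpace X] {μ : Measure X}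
    [NormedAddCommGroup F] [InnerProductSpace ℝ F] (f : Lp F 2 μ) {g : X → F}
    (hg : MemLp g 2 μ) : |∫ x, ⟪f x, g x⟫ ∂μ| ≤ ‖f‖ * √(∫ x, ‖g x‖ ^ 2 ∂μ) := by
  rw [integral_inner_eq_inner_toLp f hg, ← sq_norm_toLp_eq_integral hg,
    Real.sqrt_sq (norm_nonneg _)]
  exact abs_real_inner_le_norm _ _

/-- The ambient Hilbert space of `H1 U`. -/
abbrev GraphSpace (U : Set (Rn d)) : Type :=
  WithLp 2 (Lp ℝ 2 (volume.restrict U) × Lp (Rn d) 2 (volume.restrict U))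

/-- `valH1` as a continuous linear map. -/
noncomputable def valL (U : Set (Rn d)) : H1 U →L[ℝ] Lp ℝ 2 (volume.restrict U) :=
  (WithLp.fstL 2 ℝ _ _).comp (H1 U).subtypeL

/-- `gradH1` as a continuous linear map. -/
noncomputable def gradL (U : Set (Rn d)) : H1 U →L[ℝ] Lp (Rn d) 2 (volume.restrict U) :=
  (WithLp.sndL 2 ℝ _ _).comp (H1 U).subtypeL

@[simp] theorem valL_apply {U : Set (Rn d)} (w : H1 U) : valL U w = valH1 w := rfl

theorem sq_norm_H1 {U : Set (Rn d)} (w : H1 U) : ‖w‖ ^ 2 = ‖valH1 w‖ ^ 2 + ‖gradH1 w‖ ^ 2 :=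
  WithLp.prod_norm_sq_eq_of_L2 w.1

theorem norm_valH1_le {U : Set (Rn d)} (w : H1 U) : ‖valH1 w‖ ≤ ‖w‖ :=
  le_of_sq_le_sq (by rw [sq_norm_H1]; nlinarith [sq_nonneg ‖gradH1 w‖]) (norm_nonneg _)

theorem norm_gradH1_le {U : Set (Rn d)} (w : H1 U) : ‖gradH1 w‖ ≤ ‖w‖ :=
  le_of_sq_le_sq (by rw [sq_norm_H1]; nlinarith [sq_nonneg ‖valH1 w‖]) (norm_nonneg _)

/-- For a fixed test function, both sides of the weak gradient identity are `L²` inner products with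
fixed elements, hence continuous on the graph space. -/
theorem isClosed_H1 (U : Set (Rn d)) : IsClosed (H1 U : Set (GraphSpace U)) := by
  have : (H1 U : Set (GraphSpace U)) = ⋂ (ζ : Rn d → ℝ) (_ : ContDiff ℝ ∞ ζ)
      (_ : HasCompactSupport ζ) (_ : tsupport ζ ⊆ U) (v : Rn d),
      {p : GraphSpace U | ∫ x in U, p.fst x * fderiv ℝ ζ x v = - ∫ x in U, ⟪p.snd x, v⟫ * ζ x} := by
    ext p
    simp only [mem_iInter]
    rfl
  rw [this]
  refine isClosed_iInter fun ζ => isClosed_iInter fun hζ => isClosed_iInter fun hc =>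
    isClosed_iInter fun _ => isClosed_iInter fun v => isClosed_eq ?_ (Continuous.neg ?_)
  · have h1 : MemLp (fun x => fderiv ℝ ζ x v) 2 (volume.restrict U) :=
      ((hζ.continuous_fderiv (by simp)).clm_apply continuous_const).memLp_of_hasCompactSupport
        (hc.fderiv_apply ℝ v)
    have h2 : ∀ p : GraphSpace U, ∫ x in U, p.fst x * fderiv ℝ ζ x v
        = ⟪WithLp.fstL 2 ℝ _ _ p, h1.toLp _⟫ := fun p => by
      rw [← integral_inner_eq_inner_toLp]
      simp [mul_comm]
    simp only [h2]
    fun_prop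
  · have h1 : MemLp (fun x => ζ x • v) 2 (volume.restrict U) :=
      (hζ.continuous.smul continuous_const).memLp_of_hasCompactSupport hc.smul_right
    have h2 : ∀ p : GraphSpace U, ∫ x in U, ⟪p.snd x, v⟫ * ζ x
        = ⟪WithLp.sndL 2 ℝ _ _ p, h1.toLp _⟫ := fun p => by
      rw [← integral_inner_eq_inner_toLp]
      simp [inner_smul_right, mul_comm]
    simp only [h2]
    fun_prop

instance (U : Set (Rn d)) : CompleteSpace (H1 U) :=
  (isClosed_H1 U).completeSpace_coe

theorem eq_zero_of_hasWeakGradient_zero {U : Set (Rn d)} (hU : IsOpen U)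
    {G : Lp (Rn d) 2 (volume.restrict U)} (hG : HasWeakGradient U 0 G) : G = 0 := by
  have hi : ∀ v : Rn d, ∀ᵐ x ∂volume.restrict U, ⟪G x, v⟫ = 0 := by
    intro v
    rw [ae_restrict_iff' hU.measurableSet]
    refine hU.ae_eq_zero_of_integral_contDiff_smul_eq_zero ?_ fun ζ hζ hc hs => ?_
    · exact locallyIntegrableOn_of_locallyIntegrable_restrict
        (((Lp.memLp G).inner_const v).locallyIntegrable one_le_two)
    · have h1 := hG ζ hζ hc hs v
      rw [← setIntegral_eq_integral_of_forall_compl_eq_zero (s := U) fun x hx => by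
        rw [image_eq_zero_of_notMem_tsupport fun h => hx (hs h), zero_smul]]
      simp only [Pi.zero_apply, zero_mul, integral_zero, zero_eq_neg] at h1
      simpa [mul_comm] using h1
  have hall : ∀ᵐ x ∂volume.restrict U, ∀ i : Fin d, ⟪G x, EuclideanSpace.single i (1 : ℝ)⟫ = 0 :=
    ae_all_iff.2 fun i => hi _
  refine (Lp.eq_zero_iff_ae_eq_zero).2 ?_
  filter_upwards [hall] with x hx
  ext i
  simpa [EuclideanSpace.inner_single_right] using hx i

/-- Weak gradients on open sets are unique. This makes the `L²` form definite on `H¹` and the choice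
inside `weakGrad` immaterial. -/
theorem H1_eq_zero_of_valH1_eq_zero {U : Set (Rn d)} (hU : IsOpen U) {w : H1 U}
    (hw : valH1 w = 0) : w = 0 := by
  have hG : gradH1 w = 0 := by
    refine eq_zero_of_hasWeakGradient_zero hU fun ζ hζ hc hs v => ?_
    have h1 := w.2 ζ hζ hc hs v
    change ∫ x in U, valH1 w x * fderiv ℝ ζ x v = - ∫ x in U, ⟪gradH1 w x, v⟫ * ζ x at h1
    rw [← h1]
    refine integral_congr_ae ?_
    rw [hw]
    filter_upwards [Lp.coeFn_zero ℝ 2 (volume.restrict U)] with x hx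
    rw [hx]
  have := sq_norm_H1 w
  rw [hw, hG] at this
  simpa using this

theorem H1_ext {U : Set (Rn d)} (hU : IsOpen U) {w w' : H1 U} (h : valH1 w = valH1 w') :
    w = w' := by
  refine sub_eq_zero.1 (H1_eq_zero_of_valH1_eq_zero hU ?_)
  rw [← valL_apply, map_sub, valL_apply, valL_apply, h, sub_self]

/-- Smooth functions belong to `H¹(U)` for bounded `U`. -/
theorem exists_H1_of_contDiff {U : Set (Rn d)} (hU : IsOpen U)
    (hb : Bornology.IsBounded U) {u : Rn d → ℝ} (hu : ContDiff ℝ ∞ u) :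
    ∃ w : H1 U, valH1 w =ᵐ[volume.restrict U] u := by
  have : IsFiniteMeasure (volume.restrict U) := ⟨by simpa using hb.measure_lt_top⟩
  have hcpt := hb.isCompact_closure
  have hmem : ∀ {F : Type} [NormedAddCommGroup F] {f : Rn d → F}, Continuous f →
      MemLp f 2 (volume.restrict U) := by
    intro F _ f hf
    obtain ⟨C, hC⟩ := hcpt.exists_bound_of_continuousOn hf.continuousOn
    refine MemLp.of_bound hf.aestronglyMeasurable C ?_
    exact (ae_restrict_iff' hU.measurableSet).2 (.of_forall fun x hx => hC x (subset_closure hx))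
  have hgc : Continuous (gradient u) :=
    (InnerProductSpace.toDual ℝ (Rn d)).symm.continuous.comp (hu.continuous_fderiv (by simp))
  have h1 := hmem hu.continuous
  have h2 := hmem hgc
  refine ⟨⟨WithLp.toLp 2 (h1.toLp u, h2.toLp _), fun ζ hζ hc hs v => ?_⟩, h1.coeFn_toLp⟩
  have e1 : ∫ x in U, h1.toLp u x * fderiv ℝ ζ x v = ∫ x in U, u x * fderiv ℝ ζ x v := by
    refine integral_congr_ae ?_
    filter_upwards [h1.coeFn_toLp] with x hx
    rw [hx]
  have e2 : ∫ x in U, ⟪h2.toLp (gradient u) x, v⟫ * ζ x = ∫ x in U, fderiv ℝ u x v * ζ x := by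
    refine integral_congr_ae ?_
    filter_upwards [h2.coeFn_toLp] with x hx
    rw [hx]
    simp [gradient]
  change ∫ x in U, h1.toLp u x * fderiv ℝ ζ x v = - ∫ x in U, ⟪h2.toLp (gradient u) x, v⟫ * ζ x
  have hfd : Continuous fun x => fderiv ℝ ζ x v :=
    (hζ.continuous_fderiv (by simp)).clm_apply continuous_const
  have hfu : Continuous fun x => fderiv ℝ u x v :=
    (hu.continuous_fderiv (by simp)).clm_apply continuous_const
  have hz : ∀ x ∉ U, ζ x = 0 := fun x hx => image_eq_zero_of_notMem_tsupport fun h => hx (hs h)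
  have hz' : ∀ x ∉ U, fderiv ℝ ζ x v = 0 := fun x hx => by
    have : x ∉ tsupport (fderiv ℝ ζ) := fun h => hx (hs (tsupport_fderiv_subset ℝ h))
    rw [image_eq_zero_of_notMem_tsupport this]
    rfl
  rw [e1, e2, setIntegral_eq_integral_of_forall_compl_eq_zero fun x hx => by rw [hz' x hx, mul_zero],
    setIntegral_eq_integral_of_forall_compl_eq_zero fun x hx => by rw [hz x hx, mul_zero]]
  refine integral_mul_fderiv_eq_neg_fderiv_mul_of_integrable ?_ ?_ ?_
    (fun x _ => (hu.differentiable (by simp)) x) (fun x _ => (hζ.differentiable (by simp)) x)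
  · exact (hfu.mul hζ.continuous).integrable_of_hasCompactSupport hc.mul_left
  · exact (hu.continuous.mul hfd).integrable_of_hasCompactSupport (hc.fderiv_apply ℝ v).mul_left
  · exact (hu.continuous.mul hζ.continuous).integrable_of_hasCompactSupport hc.mul_left

/-- Polynomials in the first coordinate embed into `H¹(U)`: one that vanishes almost everywhere on
`U` vanishes on a segment in that direction, so it has infinitely many roots. -/
theorem not_finiteDimensional_H1 (hd : 1 ≤ d) {U : Set (Rn d)} (hU : IsOpen U)
    (hb : Bornology.IsBounded U) (hne : U.Nonempty) : ¬ FiniteDimensional ℝ (H1 U) := by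
  intro hfin
  let i₀ : Fin d := ⟨0, hd⟩
  have hsm : ∀ p : Polynomial ℝ, ContDiff ℝ ∞ fun x : Rn d => p.eval (x i₀) := fun p => by
    have h1 : ContDiff ℝ ∞ fun x : Rn d => x i₀ := (EuclideanSpace.proj (𝕜 := ℝ) i₀).contDiff
    have h2 := (p.contDiff_aeval (𝕜 := ℝ) (n := ∞)).comp h1
    simp only [Polynomial.coe_aeval_eq_eval] at h2
    exact h2
  choose W hW using fun p => exists_H1_of_contDiff hU hb (hsm p)
  have hext : ∀ {w w' : H1 U} {f : Rn d → ℝ}, valH1 w =ᵐ[volume.restrict U] f →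
      valH1 w' =ᵐ[volume.restrict U] f → w = w' := fun h h' =>
    H1_ext hU (Lp.ext (h.trans h'.symm))
  let Φ : Polynomial ℝ →ₗ[ℝ] H1 U :=
    { toFun := W
      map_add' := fun p q => by
        refine hext (hW _) ?_
        rw [← valL_apply, map_add]
        filter_upwards [Lp.coeFn_add (valL U (W p)) (valL U (W q)), hW p, hW q] with x h1 h2 h3
        simp_all
      map_smul' := fun r p => by
        refine hext (hW _) ?_
        rw [← valL_apply, map_smul]
        filter_upwards [Lp.coeFn_smul r (valL U (W p)), hW p] with x h1 h2
        simp_all }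
  have hinj : Function.Injective Φ := by
    refine (injective_iff_map_eq_zero Φ).2 fun p hp => ?_
    have h0 : valH1 (W p) = 0 := by
      have : W p = 0 := hp
      rw [this, ← valL_apply, map_zero]
    have h1 : ∀ᵐ x ∂volume.restrict U, p.eval (x i₀) = 0 := by
      filter_upwards [hW p, Lp.coeFn_zero ℝ 2 (volume.restrict U)] with x h2 h3
      rw [← h2, h0, h3]
      rfl
    have h2 : ∀ x ∈ U, p.eval (x i₀) = 0 :=
      fun x hx => Measure.eqOn_open_of_ae_eq (g := fun _ => (0 : ℝ)) h1 hU
        (hsm p).continuous.continuousOn continuousOn_const hx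
    obtain ⟨x₀, hx₀⟩ := hne
    refine Polynomial.eq_zero_of_infinite_isRoot p ?_
    have hcont : Continuous fun t : ℝ => x₀ + t • EuclideanSpace.single i₀ (1 : ℝ) := by fun_prop
    have hnhds : {t : ℝ | x₀ + t • EuclideanSpace.single i₀ (1 : ℝ) ∈ U} ∈ 𝓝 (0 : ℝ) :=
      hcont.continuousAt.preimage_mem_nhds (hU.mem_nhds (by simpa using hx₀))
    have hinf := infinite_of_mem_nhds (0 : ℝ) hnhds
    refine (hinf.image (f := fun t => x₀ i₀ + t) (fun a _ b _ h => by simpa using h)).mono ?_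
    rintro _ ⟨t, ht, rfl⟩
    simpa using h2 _ ht
  exact Polynomial.not_finite (R := ℝ) (Module.Finite.of_injective Φ hinj)

end SobolevBasics

/-! ### Translation estimates and duality with test functions. -/

section Rellich

open Filter

variable {d : ℕ} {Ω : Set (Rn d)}

theorem abs_integral_inner_mul_le (G : Lp (Rn d) 2 (volume.restrict Ω)) (z : Rn d)
    {ζ : Rn d → ℝ} (hζ : Continuous ζ) (hc : HasCompactSupport ζ) :
    |∫ x in Ω, ⟪G x, z⟫ * ζ x| ≤ ‖z‖ * ‖G‖ * √(∫ x, ζ x ^ 2) := by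
  have h3 : MemLp (fun x => ζ x • z) 2 (volume.restrict Ω) :=
    (hζ.smul continuous_const).memLp_of_hasCompactSupport hc.smul_right
  have h4 := abs_integral_inner_le G h3
  have h5 : ∫ x in Ω, ‖ζ x • z‖ ^ 2 ≤ ‖z‖ ^ 2 * ∫ x, ζ x ^ 2 := by
    have hi : Integrable (fun x => ζ x ^ 2) :=
      have h2 : HasCompactSupport fun x => ζ x ^ 2 := hc.mono fun x => by simp
      (hζ.pow 2).integrable_of_hasCompactSupport h2
    calc ∫ x in Ω, ‖ζ x • z‖ ^ 2 = ‖z‖ ^ 2 * ∫ x in Ω, ζ x ^ 2 := by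
          rw [← integral_const_mul]
          congr 1 with x
          rw [norm_smul, mul_pow, Real.norm_eq_abs, sq_abs, mul_comm]
      _ ≤ ‖z‖ ^ 2 * ∫ x, ζ x ^ 2 := by
          exact mul_le_mul_of_nonneg_left
            (setIntegral_le_integral hi (.of_forall fun x => sq_nonneg _)) (sq_nonneg _)
  have h6 : √(∫ x in Ω, ‖ζ x • z‖ ^ 2) ≤ ‖z‖ * √(∫ x, ζ x ^ 2) := by
    refine (Real.sqrt_le_sqrt h5).trans ?_
    rw [Real.sqrt_mul (sq_nonneg _), Real.sqrt_sq (norm_nonneg _)]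
  have h7 : ∀ x, ⟪G x, z⟫ * ζ x = ⟪G x, ζ x • z⟫ := fun x => by rw [inner_smul_right, mul_comm]
  simp only [h7]
  calc |∫ x in Ω, ⟪G x, ζ x • z⟫| ≤ ‖G‖ * (‖z‖ * √(∫ x, ζ x ^ 2)) := h4.trans (by gcongr)
    _ = _ := by ring

/-- Moving a test function along a segment that keeps its support in `Ω` changes its pairing with
`w ∈ H¹(Ω)` by at most the length of the segment times `‖∇w‖`. -/
theorem abs_integral_translate_sub_le [IsFiniteMeasure (volume.restrict Ω)] (w : H1 Ω)
    {ζ : Rn d → ℝ} (hζ : ContDiff ℝ ∞ ζ) (hc : HasCompactSupport ζ) {z : Rn d}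
    (hz : ∀ σ ∈ Icc (0 : ℝ) 1, ∀ x ∈ tsupport ζ, x + σ • z ∈ Ω) :
    |(∫ x in Ω, valH1 w x * ζ (x - z)) - ∫ x in Ω, valH1 w x * ζ x|
      ≤ ‖z‖ * ‖gradH1 w‖ * √(∫ x, ζ x ^ 2) := by
  have hfc : Continuous (fderiv ℝ ζ) := hζ.continuous_fderiv (by simp)
  obtain ⟨C, hC⟩ := (hc.fderiv ℝ).exists_bound_of_continuous hfc
  have hC0 : 0 ≤ C := (norm_nonneg _).trans (hC 0)
  have hint : Integrable (valH1 w) (volume.restrict Ω) := (Lp.memLp _).integrable one_le_two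
  have hmeas : AEStronglyMeasurable (valH1 w) (volume.restrict Ω) := hint.aestronglyMeasurable
  -- The shift is put on the smooth `ζ`, so `f` is differentiable although `w` is not. The
  -- translated test functions stay supported in `Ω`, which turns the derivative of `f` into a
  -- pairing with the weak gradient; the mean value inequality concludes.
  set f : ℝ → ℝ := fun σ => ∫ x in Ω, valH1 w x * ζ (x - σ • z) with hf
  have hderiv : ∀ σ, HasDerivAt f (∫ x in Ω, valH1 w x * fderiv ℝ ζ (x - σ • z) (-z)) σ := by
    intro σ
    refine (hasDerivAt_integral_of_dominated_loc_of_deriv_le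
      (F' := fun σ x => valH1 w x * fderiv ℝ ζ (x - σ • z) (-z))
      (bound := fun x => |valH1 w x| * (C * ‖z‖)) univ_mem ?_ ?_ ?_ ?_ ?_ ?_).2
    · exact .of_forall fun τ => hmeas.mul
        (hζ.continuous.comp (continuous_id.sub continuous_const)).aestronglyMeasurable
    · have h1 : MemLp (fun x => ζ (x - σ • z)) 2 (volume.restrict Ω) :=
        (hζ.continuous.comp (continuous_id.sub continuous_const)).memLp_of_hasCompactSupport
          (hc.comp_homeomorph (Homeomorph.subRight (σ • z)))
      exact (Lp.memLp (valH1 w)).integrable_mul h1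
    · exact hmeas.mul ((hfc.comp (continuous_id.sub continuous_const)).clm_apply
        continuous_const).aestronglyMeasurable
    · refine .of_forall fun x τ _ => ?_
      rw [norm_mul, Real.norm_eq_abs]
      gcongr
      refine (ContinuousLinearMap.le_opNorm _ _).trans ?_
      rw [norm_neg]
      gcongr
      exact hC _
    · exact hint.abs.mul_const _
    · refine .of_forall fun x τ _ => ?_
      have h1 : HasDerivAt (fun τ : ℝ => x - τ • z) (-z) τ := by
        simpa using ((hasDerivAt_id τ).smul_const z).const_sub x
      have h2 : HasFDerivAt ζ (fderiv ℝ ζ (x - τ • z)) (x - τ • z) :=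
        (hζ.differentiable (by simp) _).hasFDerivAt
      exact (h2.comp_hasDerivAt τ h1).const_mul _
  have hbound : ∀ σ ∈ Icc (0 : ℝ) 1,
      ‖∫ x in Ω, valH1 w x * fderiv ℝ ζ (x - σ • z) (-z)‖
        ≤ ‖z‖ * ‖gradH1 w‖ * √(∫ x, ζ x ^ 2) := by
    intro σ hσ
    set ζ' : Rn d → ℝ := fun x => ζ (x - σ • z) with hζ'
    have hζ's : ContDiff ℝ ∞ ζ' := hζ.comp (contDiff_id.sub contDiff_const)
    have hζ'c : HasCompactSupport ζ' := hc.comp_homeomorph (Homeomorph.subRight (σ • z))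
    have hζ't : tsupport ζ' ⊆ Ω := by
      intro y hy
      have h1 : y ∈ (Homeomorph.subRight (σ • z)) ⁻¹' tsupport ζ := by
        rwa [← tsupport_comp_eq_preimage]
      simpa using hz σ hσ _ h1
    have h1 := w.2 ζ' hζ's hζ'c hζ't z
    change ∫ x in Ω, valH1 w x * fderiv ℝ ζ' x z = - ∫ x in Ω, ⟪gradH1 w x, z⟫ * ζ' x at h1
    have h2 : ∀ x, fderiv ℝ ζ (x - σ • z) (-z) = - fderiv ℝ ζ' x z := fun x => by
      rw [hζ', fderiv_comp_sub, map_neg]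
    simp only [h2, mul_neg, integral_neg, h1, neg_neg]
    refine (abs_integral_inner_mul_le (gradH1 w) z hζ's.continuous hζ'c).trans_eq ?_
    rw [hζ', integral_sub_right_eq_self (fun x => ζ x ^ 2) (σ • z)]
  have := norm_image_sub_le_of_norm_deriv_le_segment_01'
    (fun σ _ => (hderiv σ).hasDerivWithinAt) (fun σ hσ => hbound σ ⟨hσ.1, hσ.2.le⟩)
  simpa [hf] using this

/-- The integral of `u` over `Ω ∩ (y + D)`. -/
noncomputable def windowIntegral (Ω D : Set (Rn d)) (u : Rn d → ℝ) (y : Rn d) : ℝ :=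
  ∫ x in Ω, D.indicator (fun _ => (1 : ℝ)) (x - y) * u x

/-- Fubini and the substitution `y = x - z`. Averaging over shifts moves the averaging from the test
function to `u`. -/
theorem integral_integral_translate_eq {D : Set (Rn d)} (hD : MeasurableSet D)
    (hDfin : volume D < ⊤) {u : Rn d → ℝ} (hu : Integrable u (volume.restrict Ω))
    {ζ : Rn d → ℝ} (hζ : Continuous ζ) (hc : HasCompactSupport ζ) :
    IntegrableOn (fun z => ∫ x in Ω, u x * ζ (x - z)) D ∧
    ∫ z in D, ∫ x in Ω, u x * ζ (x - z) = ∫ y, ζ y * windowIntegral Ω D u y := by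
  have : IsFiniteMeasure (volume.restrict D) := ⟨by simpa using hDfin⟩
  obtain ⟨C, hC⟩ := hc.exists_bound_of_continuous hζ
  have hind : Measurable (D.indicator fun _ => (1 : ℝ)) := measurable_const.indicator hD
  have hind1 : ∀ x, ‖D.indicator (fun _ => (1 : ℝ)) x‖ ≤ 1 := fun x =>
    (norm_indicator_le_norm_self _ _).trans (by simp)
  have i1 : Integrable (Function.uncurry fun (z x : Rn d) => u x * ζ (x - z))
      ((volume.restrict D).prod (volume.restrict Ω)) := by
    have h1 : Integrable (fun p : Rn d × Rn d => (1 : ℝ) * u p.2)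
        ((volume.restrict D).prod (volume.restrict Ω)) := (integrable_const 1).mul_prod hu
    have h2 := h1.bdd_mul (f := fun p : Rn d × Rn d => ζ (p.2 - p.1)) (c := C)
      (hζ.comp (continuous_snd.sub continuous_fst)).aestronglyMeasurable (.of_forall fun p => hC _)
    refine h2.congr (.of_forall fun p => ?_)
    simp only [Function.uncurry]
    ring
  have i2 : Integrable (Function.uncurry fun (x y : Rn d) =>
      D.indicator (fun _ => (1 : ℝ)) (x - y) * (u x * ζ y))
      ((volume.restrict Ω).prod volume) := by
    have h1 := hu.mul_prod (hζ.integrable_of_hasCompactSupport hc (μ := volume))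
    exact h1.bdd_mul (c := 1) (hind.comp (measurable_fst.sub measurable_snd)).aestronglyMeasurable
      (.of_forall fun p => hind1 _)
  refine ⟨i1.integral_prod_left, ?_⟩
  rw [integral_integral_swap i1]
  have h1 : ∀ x, ∫ z in D, u x * ζ (x - z)
      = ∫ y, D.indicator (fun _ => (1 : ℝ)) (x - y) * (u x * ζ y) := by
    intro x
    rw [← integral_indicator hD, ← integral_sub_left_eq_self _ _ x]
    congr 1 with y
    by_cases h : x - y ∈ D <;> simp [h]
  simp only [h1]
  rw [integral_integral_swap i2]
  congr 1 with y
  rw [windowIntegral, ← integral_const_mul]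
  congr 1 with x
  ring

/-- Test functions determine the `L²` norm. -/
theorem integral_sq_le_of_forall_test {V : Set (Rn d)} (hV : IsOpen V) {f : Rn d → ℝ}
    (hf : MemLp f 2 (volume.restrict V)) {K : ℝ} (hK : 0 ≤ K)
    (h : ∀ ζ : Rn d → ℝ, ContDiff ℝ ∞ ζ → HasCompactSupport ζ → tsupport ζ ⊆ V →
      |∫ x in V, f x * ζ x| ≤ K * √(∫ x, ζ x ^ 2)) : ∫ x in V, f x ^ 2 ≤ K ^ 2 := by
  let T : Submodule ℝ (Lp ℝ 2 (volume.restrict V)) :=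
    { carrier := {g | ∃ ζ : Rn d → ℝ, ContDiff ℝ ∞ ζ ∧ HasCompactSupport ζ ∧ tsupport ζ ⊆ V ∧
        g =ᵐ[volume.restrict V] ζ}
      zero_mem' := ⟨0, contDiff_const, HasCompactSupport.zero, by simp [tsupport],
        Lp.coeFn_zero _ _ _⟩
      add_mem' := by
        rintro g g' ⟨ζ, h1, h2, h3, h4⟩ ⟨ζ', h1', h2', h3', h4'⟩
        refine ⟨ζ + ζ', h1.add h1', h2.add h2', (tsupport_add ζ ζ').trans (union_subset h3 h3'), ?_⟩
        exact (Lp.coeFn_add g g').trans (h4.add h4')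
      smul_mem' := by
        rintro r g ⟨ζ, h1, h2, h3, h4⟩
        refine ⟨r • ζ, contDiff_const.smul h1, h2.smul_left (f := fun _ => r),
          (tsupport_smul_subset_right (fun _ => r) ζ).trans h3, ?_⟩
        exact (Lp.coeFn_smul r g).trans (h4.const_smul r) }
  -- By the fundamental lemma, only zero is orthogonal to all test functions. The assumed bound
  -- therefore extends by density to every `g`, in particular to `f` itself, where it reads `‖f‖² ≤
  -- K ‖f‖`.
  have hdense : T.topologicalClosure = ⊤ := by
    rw [Submodule.topologicalClosure_eq_top_iff, Submodule.eq_bot_iff]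
    intro g hg
    refine Lp.eq_zero_iff_ae_eq_zero.2 ?_
    rw [EventuallyEq, ae_restrict_iff' hV.measurableSet]
    refine hV.ae_eq_zero_of_integral_contDiff_smul_eq_zero ?_ fun ζ hζ hc hs => ?_
    · exact locallyIntegrableOn_of_locallyIntegrable_restrict
        ((Lp.memLp g).locallyIntegrable one_le_two)
    · have h2 : MemLp ζ 2 (volume.restrict V) := hζ.continuous.memLp_of_hasCompactSupport hc
      have h1 := (Submodule.mem_orthogonal' _ _).1 hg (h2.toLp ζ) ⟨ζ, hζ, hc, hs, h2.coeFn_toLp⟩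
      rw [← integral_inner_eq_inner_toLp] at h1
      rw [← setIntegral_eq_integral_of_forall_compl_eq_zero (s := V) fun x hx => by
        rw [image_eq_zero_of_notMem_tsupport fun h => hx (hs h), zero_smul]]
      simpa using h1
  have hle : ∀ g ∈ T.topologicalClosure, |⟪hf.toLp f, g⟫| ≤ K * ‖g‖ := by
    have hcl : IsClosed {g : Lp ℝ 2 (volume.restrict V) | |⟪hf.toLp f, g⟫| ≤ K * ‖g‖} :=
      isClosed_le (by fun_prop) (by fun_prop)
    refine fun g hg => closure_minimal (t := {g | |⟪hf.toLp f, g⟫| ≤ K * ‖g‖}) ?_ hcl hg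
    rintro g ⟨ζ, h1, h2, h3, h4⟩
    have hζ : MemLp ζ 2 (volume.restrict V) := h1.continuous.memLp_of_hasCompactSupport h2
    have hg : g = hζ.toLp ζ := Lp.ext (h4.trans hζ.coeFn_toLp.symm)
    have h5 : ⟪hf.toLp f, g⟫ = ∫ x in V, f x * ζ x := by
      rw [hg, ← integral_inner_eq_inner_toLp]
      refine integral_congr_ae ?_
      filter_upwards [hf.coeFn_toLp] with x hx
      rw [hx]
      simp [mul_comm]
    have h6 : ‖g‖ = √(∫ x, ζ x ^ 2) := by
      rw [← Real.sqrt_sq (norm_nonneg g), hg, sq_norm_toLp_eq_integral,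
        setIntegral_eq_integral_of_forall_compl_eq_zero]
      · simp
      · intro x hx
        rw [image_eq_zero_of_notMem_tsupport fun h => hx (h3 h)]
        simp
    change |⟪hf.toLp f, g⟫| ≤ K * ‖g‖
    rw [h5, h6]
    exact h ζ h1 h2 h3
  have hF := hle (hf.toLp f) (by rw [hdense]; trivial)
  rw [real_inner_self_eq_norm_sq, abs_of_nonneg (sq_nonneg _)] at hF
  have h1 : ‖hf.toLp f‖ ≤ K := by
    by_contra! hlt
    nlinarith [norm_nonneg (hf.toLp f)]
  have h2 := sq_norm_toLp_eq_integral hf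
  simp only [Real.norm_eq_abs, sq_abs] at h2
  rw [← h2]
  gcongr

end Rellich

/-! ### Compactness of the embedding of `H¹` into `L²` through the cone property. -/

section RellichCompactness

open Filter

variable {d : ℕ} {Ω : Set (Rn d)}

theorem abs_integral_mul_le {X : Type*} [MeasurableSpace X] {μ : Measure X} {f g : X → ℝ}
    (hf : MemLp f 2 μ) (hg : MemLp g 2 μ) :
    |∫ x, f x * g x ∂μ| ≤ √(∫ x, f x ^ 2 ∂μ) * √(∫ x, g x ^ 2 ∂μ) := by
  have h1 := abs_integral_inner_le (hf.toLp f) hg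
  have h2 := sq_norm_toLp_eq_integral hf
  simp only [Real.norm_eq_abs, sq_abs] at h1 h2
  rw [← h2, Real.sqrt_sq (norm_nonneg _)]
  refine le_of_eq_of_le (congrArg _ (integral_congr_ae ?_)) h1
  filter_upwards [hf.coeFn_toLp] with x hx
  rw [hx]
  simp [mul_comm]

theorem memLp_window {D : Set (Rn d)} (hD : MeasurableSet D)
    [IsFiniteMeasure (volume.restrict Ω)] (y : Rn d) :
    MemLp (fun x => D.indicator (fun _ => (1 : ℝ)) (x - y)) 2 (volume.restrict Ω) := by
  refine MemLp.of_bound ?_ 1 (.of_forall fun x =>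
    (norm_indicator_le_norm_self _ _).trans (by simp))
  exact ((measurable_const.indicator hD).comp
    (measurable_id.sub measurable_const)).aestronglyMeasurable

theorem windowIntegral_eq_inner {D : Set (Rn d)} (hD : MeasurableSet D)
    [IsFiniteMeasure (volume.restrict Ω)] (u : Lp ℝ 2 (volume.restrict Ω)) (y : Rn d) :
    windowIntegral Ω D u y = ⟪u, (memLp_window (Ω := Ω) hD y).toLp _⟫ := by
  rw [← integral_inner_eq_inner_toLp]
  rfl

theorem abs_windowIntegral_le {D : Set (Rn d)} (hD : MeasurableSet D)
    [IsFiniteMeasure (volume.restrict Ω)] (u : Lp ℝ 2 (volume.restrict Ω)) (y : Rn d) :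
    |windowIntegral Ω D u y| ≤ ‖u‖ * √(volume.real Ω) := by
  have h1 := abs_integral_inner_le u (memLp_window (Ω := Ω) hD y)
  refine h1.trans ?_
  gcongr
  calc _ ≤ ∫ x in Ω, (1 : ℝ) := by
        refine integral_mono_of_nonneg (.of_forall fun x => by positivity)
          (integrable_const _) (.of_forall fun x => ?_)
        have : ‖D.indicator (fun _ => (1 : ℝ)) (x - y)‖ ≤ 1 :=
          (norm_indicator_le_norm_self _ _).trans (by simp)
        exact pow_le_one₀ (norm_nonneg _) this
    _ = _ := by simp

theorem aestronglyMeasurable_windowIntegral {D : Set (Rn d)} (hD : MeasurableSet D)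
    (u : Lp ℝ 2 (volume.restrict Ω)) (μ : Measure (Rn d)) [SFinite μ] :
    AEStronglyMeasurable (windowIntegral Ω D u) μ := by
  have h1 : AEStronglyMeasurable
      (fun p : Rn d × Rn d => D.indicator (fun _ => (1 : ℝ)) (p.2 - p.1) * u p.2)
      (μ.prod (volume.restrict Ω)) :=
    ((measurable_const.indicator hD).comp
      (measurable_snd.sub measurable_fst)).aestronglyMeasurable.mul
      (Lp.aestronglyMeasurable u).comp_snd
  exact h1.integral_prod_right'

/-- By duality it suffices to pair `w` with test functions supported in `V`. Replacing such a
pairing by its average over shifts `z` in a ball inside the cone costs at most `‖z‖ ‖∇w‖ ≤ 2 s ‖∇w‖`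
times the norm of the test function, and the average is a pairing with the window integrals of `w`.
-/
theorem integral_sq_le_of_cone (hΩ : IsOpen Ω) [IsFiniteMeasure (volume.restrict Ω)]
    {V : Set (Rn d)} (hV : IsOpen V) (hVΩ : V ⊆ Ω) {e : Rn d} (he : ‖e‖ ≤ 1) {κ s : ℝ}
    (hκ : 0 < κ) (hκ1 : κ ≤ 1) (hs : 0 < s)
    (hcone : ∀ y ∈ V, ∀ τ ∈ Icc 0 s, ∀ ξ, ‖ξ‖ ≤ κ → y + τ • (e + ξ) ∈ Ω) (w : H1 Ω) :
    ∫ x in V, valH1 w x ^ 2 ≤ (2 * s * ‖gradH1 w‖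
      + (volume.real (Metric.closedBall (s • e) (κ * s)))⁻¹ *
        √(∫ y in V, windowIntegral Ω (Metric.closedBall (s • e) (κ * s)) (valH1 w) y ^ 2)) ^ 2 := by
  set D := Metric.closedBall (s • e) (κ * s) with hDdef
  have hD : MeasurableSet D := Metric.isClosed_closedBall.measurableSet
  have hDfin : volume D < ⊤ := measure_closedBall_lt_top
  have hm : 0 < volume.real D :=
    ENNReal.toReal_pos (Metric.measure_closedBall_pos volume _ (by positivity)).ne' hDfin.ne
  have hVle : volume.restrict V ≤ volume.restrict Ω := Measure.restrict_mono hVΩ le_rfl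
  have : IsFiniteMeasure (volume.restrict V) := isFiniteMeasure_of_le _ hVle
  have hwin : MemLp (windowIntegral Ω D (valH1 w)) 2 (volume.restrict V) :=
    MemLp.of_bound (aestronglyMeasurable_windowIntegral hD _ _) _
      (.of_forall fun y => abs_windowIntegral_le hD _ y)
  refine integral_sq_le_of_forall_test hV ((Lp.memLp (valH1 w)).mono_measure hVle)
    (by positivity) fun ζ hζ hc hsupp => ?_
  have hz0 : ∀ x ∉ V, ζ x = 0 := fun x hx =>
    image_eq_zero_of_notMem_tsupport fun h => hx (hsupp h)
  rw [← setIntegral_eq_of_subset_of_forall_sdiff_eq_zero hΩ.measurableSet hVΩ fun x hx => by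
    rw [hz0 x hx.2, mul_zero]]
  set P := ∫ x in Ω, valH1 w x * ζ x with hP
  obtain ⟨hi, heq⟩ := integral_integral_translate_eq hD hDfin
    ((Lp.memLp (valH1 w)).integrable one_le_two) hζ.continuous hc
  have hshift : ∀ z ∈ D, ‖(∫ x in Ω, valH1 w x * ζ (x - z)) - P‖
      ≤ 2 * s * ‖gradH1 w‖ * √(∫ x, ζ x ^ 2) := by
    intro z hz
    rw [hDdef, mem_closedBall_iff_norm] at hz
    refine (abs_integral_translate_sub_le w hζ hc fun σ hσ x hx => ?_).trans ?_
    · have h1 : σ • z = (σ * s) • (e + (s⁻¹ • z - e)) := by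
        rw [add_sub_cancel, smul_smul, mul_assoc, mul_inv_cancel₀ hs.ne', mul_one]
      rw [h1]
      refine hcone x (hsupp hx) _ ⟨mul_nonneg hσ.1 hs.le, mul_le_of_le_one_left hs.le hσ.2⟩ _ ?_
      have h2 : s⁻¹ • z - e = s⁻¹ • (z - s • e) := by
        rw [smul_sub, smul_smul, inv_mul_cancel₀ hs.ne', one_smul]
      rw [h2, norm_smul, norm_inv, Real.norm_of_nonneg hs.le, inv_mul_le_iff₀ hs]
      linarith
    · gcongr
      have h3 : ‖z‖ ≤ ‖z - s • e‖ + ‖s • e‖ := by simpa using norm_add_le (z - s • e) (s • e)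
      rw [norm_smul, Real.norm_of_nonneg hs.le] at h3
      nlinarith
  have h1 := norm_setIntegral_le_of_norm_le_const hDfin hshift
  rw [integral_sub hi (integrableOn_const hDfin.ne), setIntegral_const, smul_eq_mul, heq,
    Real.norm_eq_abs] at h1
  have h2 : |∫ y, ζ y * windowIntegral Ω D (valH1 w) y| ≤
      √(∫ x, ζ x ^ 2) * √(∫ y in V, windowIntegral Ω D (valH1 w) y ^ 2) := by
    rw [← setIntegral_eq_integral_of_forall_compl_eq_zero (s := V) fun x hx => by
      rw [hz0 x hx, zero_mul]]
    refine (abs_integral_mul_le (hζ.continuous.memLp_of_hasCompactSupport hc) hwin).trans_eq ?_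
    rw [setIntegral_eq_integral_of_forall_compl_eq_zero (f := fun x => ζ x ^ 2) fun x hx => by
      rw [hz0 x hx, zero_pow two_ne_zero]]
  have h3 : volume.real D * |P| ≤ 2 * s * ‖gradH1 w‖ * √(∫ x, ζ x ^ 2) * volume.real D
      + √(∫ x, ζ x ^ 2) * √(∫ y in V, windowIntegral Ω D (valH1 w) y ^ 2) := by
    have h4 : volume.real D * P = (∫ y, ζ y * windowIntegral Ω D (valH1 w) y)
        - ((∫ y, ζ y * windowIntegral Ω D (valH1 w) y) - volume.real D * P) := by ring
    rw [← abs_of_pos hm, ← abs_mul, h4, abs_of_pos hm]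
    refine (abs_sub _ _).trans ?_
    linarith
  calc |P| = (volume.real D)⁻¹ * (volume.real D * |P|) := by field_simp
    _ ≤ (volume.real D)⁻¹ * (2 * s * ‖gradH1 w‖ * √(∫ x, ζ x ^ 2) * volume.real D
      + √(∫ x, ζ x ^ 2) * √(∫ y in V, windowIntegral Ω D (valH1 w) y ^ 2)) := by gcongr
    _ = _ := by field_simp

/-- Lipschitz domains have the (uniform) cone property near each point of their closure. -/
theorem HasLipschitzBoundary.exists_cone (hlip : HasLipschitzBoundary Ω) (hΩ : IsOpen Ω)
    {x : Rn d} (hx : x ∈ closure Ω) :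
    ∃ (e : Rn d) (κ s ρ : ℝ), ‖e‖ ≤ 1 ∧ 0 < κ ∧ κ ≤ 1 ∧ 0 < s ∧ 0 < ρ ∧
      ∀ y ∈ Ω ∩ Metric.ball x ρ, ∀ τ ∈ Icc 0 s, ∀ ξ, ‖ξ‖ ≤ κ → y + τ • (e + ξ) ∈ Ω := by
  by_cases hxΩ : x ∈ Ω
  · obtain ⟨r, hr, hball⟩ := Metric.isOpen_iff.1 hΩ x hxΩ
    -- At interior points the axis may be zero: the cone is a full ball.
    refine ⟨0, 1, r / 4, r / 2, by simp, one_pos, le_rfl, by positivity, by positivity, ?_⟩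
    rintro y ⟨-, hy⟩ τ hτ ξ hξ
    refine hball ?_
    rw [mem_ball_iff_norm] at hy ⊢
    have h1 : y + τ • (0 + ξ) - x = (y - x) + τ • ξ := by rw [zero_add]; abel
    rw [h1]
    have h2 := norm_add_le (y - x) (τ • ξ)
    rw [norm_smul, Real.norm_of_nonneg hτ.1] at h2
    nlinarith [hτ.1, hτ.2, norm_nonneg ξ]
  · obtain ⟨e, he, r, hr, L, g, hg, hU⟩ := hlip x ⟨hx, by rwa [hΩ.interior_eq]⟩
    have hL : (0 : ℝ) ≤ L := L.2
    -- Moving by `τ • (e + ξ)` raises the height by at least `τ (1 - ‖ξ‖)` and the graph by at most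
    -- `2 L τ ‖ξ‖`, so the point stays above the graph when `(2 L + 1) ‖ξ‖ ≤ 1`. The radii keep the
    -- shifted point within `r` of `x`.
    refine ⟨e, 1 / (2 * L + 1), r / 8, r / 2, he.le, by positivity,
      by rw [div_le_one (by positivity)]; linarith, by positivity, by positivity, ?_⟩
    rintro y ⟨hyΩ, hy⟩ τ hτ ξ hξ
    have hκ : ‖ξ‖ * (2 * L + 1) ≤ 1 := by rwa [le_div_iff₀ (by positivity)] at hξ
    have hξ1 : ‖ξ‖ ≤ 1 := by nlinarith [norm_nonneg ξ]
    rw [mem_ball_iff_norm] at hy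
    have hyr : y ∈ Metric.ball x r := by rw [mem_ball_iff_norm]; linarith
    have hyr' : y + τ • (e + ξ) ∈ Metric.ball x r := by
      rw [mem_ball_iff_norm]
      have h1 : y + τ • (e + ξ) - x = (y - x) + τ • (e + ξ) := by abel
      rw [h1]
      have h2 := norm_add_le (y - x) (τ • (e + ξ))
      rw [norm_smul, Real.norm_of_nonneg hτ.1] at h2
      have h3 := norm_add_le e ξ
      have h4 : τ * ‖e + ξ‖ ≤ r / 8 * 2 :=
        mul_le_mul hτ.2 (by linarith) (norm_nonneg _) (by positivity)
      linarith
    rw [hU _ hyr']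
    have hy1 := (hU _ hyr).1 hyΩ
    have hee : ⟪e, e⟫ = 1 := by rw [real_inner_self_eq_norm_sq, he, one_pow]
    have hin : ⟪e, y + τ • (e + ξ)⟫ = ⟪e, y⟫ + τ * (1 + ⟪e, ξ⟫) := by
      rw [inner_add_right, inner_smul_right, inner_add_right, hee]
    have hdiff : y + τ • (e + ξ) - ⟪e, y + τ • (e + ξ)⟫ • e - (y - ⟪e, y⟫ • e)
        = τ • (ξ - ⟪e, ξ⟫ • e) := by
      rw [hin]
      module
    have hinξ : |⟪e, ξ⟫| ≤ ‖ξ‖ := by simpa [he] using abs_real_inner_le_norm e ξ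
    have hn : ‖τ • (ξ - ⟪e, ξ⟫ • e)‖ ≤ τ * (2 * ‖ξ‖) := by
      rw [norm_smul, Real.norm_of_nonneg hτ.1]
      refine mul_le_mul_of_nonneg_left ?_ hτ.1
      refine (norm_sub_le _ _).trans ?_
      rw [norm_smul, he, Real.norm_eq_abs]
      linarith
    have hgl := hg.dist_le_mul (y + τ • (e + ξ) - ⟪e, y + τ • (e + ξ)⟫ • e) (y - ⟪e, y⟫ • e)
    rw [dist_eq_norm, dist_eq_norm, hdiff, Real.norm_eq_abs] at hgl
    have h5 := (abs_le.1 hgl).2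
    have h6 : (L : ℝ) * ‖τ • (ξ - ⟪e, ξ⟫ • e)‖ ≤ L * (τ * (2 * ‖ξ‖)) := by gcongr
    refine lt_of_lt_of_eq ?_ hin.symm
    have h7 := (abs_le.1 hinξ).1
    have h8 : τ * (‖ξ‖ * (2 * L + 1)) ≤ τ * 1 := mul_le_mul_of_nonneg_left hκ hτ.1
    have h9 : τ * -‖ξ‖ ≤ τ * ⟪e, ξ⟫ := mul_le_mul_of_nonneg_left h7 hτ.1
    nlinarith

/-- Sequential Banach–Alaoglu, transported from the dual by the Riesz isomorphism. -/
theorem exists_weakly_convergent_subseq {H : Type*} [NormedAddCommGroup H]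
    [InnerProductSpace ℝ H] [CompleteSpace H] [TopologicalSpace.SeparableSpace H] {u : ℕ → H}
    {M : ℝ} (hu : ∀ n, ‖u n‖ ≤ M) :
    ∃ σ : ℕ → ℕ, StrictMono σ ∧ ∃ u₀, ∀ f : H →L[ℝ] ℝ,
      Tendsto (fun n => f (u (σ n))) atTop (𝓝 (f u₀)) := by
  let J := InnerProductSpace.toDual ℝ H
  obtain ⟨L, -, σ, hσ, hL⟩ := WeakDual.isSeqCompact_closedBall ℝ H 0 M
    (x := fun n => StrongDual.toWeakDual (J (u n)))
    (fun n => by simpa using hu n)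
  refine ⟨σ, hσ, J.symm (WeakDual.toStrongDual L), fun f => ?_⟩
  have h1 := ((WeakDual.eval_continuous (J.symm f)).tendsto L).comp hL
  have h2 : ∀ v, f v = J v (J.symm f) := fun v => by
    rw [InnerProductSpace.toDual_apply_apply, real_inner_comm,
      InnerProductSpace.toDual_symm_apply]
  simp only [h2, LinearIsometryEquiv.apply_symm_apply]
  exact h1

/-- The shift length `s` is fixed first, to make the gradient term small uniformly in `n`. For this
`s` each window integral is a continuous functional of `v n`, so it tends to zero pointwise, and
dominated convergence handles its `L²` norm. -/
theorem tendsto_integral_sq_of_cone (hΩ : IsOpen Ω) [IsFiniteMeasure (volume.restrict Ω)]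
    {V : Set (Rn d)} (hV : IsOpen V) (hVΩ : V ⊆ Ω) {e : Rn d} (he : ‖e‖ ≤ 1) {κ s₀ : ℝ}
    (hκ : 0 < κ) (hκ1 : κ ≤ 1) (hs₀ : 0 < s₀)
    (hcone : ∀ y ∈ V, ∀ τ ∈ Icc 0 s₀, ∀ ξ, ‖ξ‖ ≤ κ → y + τ • (e + ξ) ∈ Ω) {v : ℕ → H1 Ω}
    {M : ℝ} (hM : ∀ n, ‖v n‖ ≤ M) (hv : ∀ f : H1 Ω →L[ℝ] ℝ, Tendsto (fun n => f (v n)) atTop (𝓝 0)) :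
    Tendsto (fun n => ∫ x in V, valH1 (v n) x ^ 2) atTop (𝓝 0) := by
  have hVle : volume.restrict V ≤ volume.restrict Ω := Measure.restrict_mono hVΩ le_rfl
  have : IsFiniteMeasure (volume.restrict V) := isFiniteMeasure_of_le _ hVle
  have hM0 : 0 ≤ M := (norm_nonneg _).trans (hM 0)
  rw [Metric.tendsto_atTop]
  intro δ hδ
  obtain ⟨η, hη, hηδ⟩ : ∃ η > 0, η ^ 2 < δ :=
    ⟨√(δ / 2), by positivity, by rw [Real.sq_sqrt (by positivity)]; linarith⟩
  obtain ⟨s, hs, hss₀, hsM⟩ : ∃ s > 0, s ≤ s₀ ∧ 2 * s * M ≤ η / 2 := by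
    refine ⟨min s₀ (η / (4 * (M + 1))), by positivity, min_le_left _ _, ?_⟩
    calc 2 * min s₀ (η / (4 * (M + 1))) * M ≤ 2 * (η / (4 * (M + 1))) * (M + 1) := by
          gcongr
          · exact min_le_right _ _
          · linarith
      _ = η / 2 := by field_simp; ring
  set D := Metric.closedBall (s • e) (κ * s) with hDdef
  have hD : MeasurableSet D := Metric.isClosed_closedBall.measurableSet
  have hlim : Tendsto (fun n => ∫ y in V, windowIntegral Ω D (valH1 (v n)) y ^ 2) atTop
      (𝓝 (∫ y in V, (0 : ℝ))) := by
    refine tendsto_integral_of_dominated_convergence (fun _ => (M * √(volume.real Ω)) ^ 2)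
      (fun n => (aestronglyMeasurable_windowIntegral hD _ _).pow 2) (integrable_const _)
      (fun n => .of_forall fun y => ?_) (.of_forall fun y => ?_)
    · rw [norm_pow, Real.norm_eq_abs]
      gcongr
      refine (abs_windowIntegral_le hD _ y).trans ?_
      gcongr
      exact (norm_valH1_le _).trans (hM n)
    · have h1 := hv ((innerSL ℝ ((memLp_window (Ω := Ω) hD y).toLp _)).comp (valL Ω))
      have h2 : ∀ n, windowIntegral Ω D (valH1 (v n)) y
          = ((innerSL ℝ ((memLp_window (Ω := Ω) hD y).toLp _)).comp (valL Ω)) (v n) := fun n => by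
        rw [windowIntegral_eq_inner hD, real_inner_comm]
        rfl
      simp only [h2]
      simpa using h1.pow 2
  have hlim2 : Tendsto (fun n => (volume.real D)⁻¹ *
      √(∫ y in V, windowIntegral Ω D (valH1 (v n)) y ^ 2)) atTop (𝓝 0) := by
    simpa using (hlim.sqrt).const_mul (volume.real D)⁻¹
  obtain ⟨N, hN⟩ := eventually_atTop.1 (hlim2.eventually_lt_const (half_pos hη))
  refine ⟨N, fun n hn => ?_⟩
  have h0 : 0 ≤ ∫ x in V, valH1 (v n) x ^ 2 := integral_nonneg fun x => sq_nonneg _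
  rw [Real.dist_eq, sub_zero, abs_of_nonneg h0]
  have h1 := integral_sq_le_of_cone hΩ hV hVΩ he hκ hκ1 hs
    (fun y hy τ hτ => hcone y hy τ ⟨hτ.1, hτ.2.trans hss₀⟩) (v n)
  refine h1.trans_lt (lt_of_le_of_lt ?_ hηδ)
  have h2 : 2 * s * ‖gradH1 (v n)‖ ≤ 2 * s * M := by
    gcongr
    exact (norm_gradH1_le _).trans (hM n)
  have h3 := hN n hn
  have h4 : 0 ≤ (volume.real D)⁻¹ * √(∫ y in V, windowIntegral Ω D (valH1 (v n)) y ^ 2) := by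
    positivity
  refine pow_le_pow_left₀ (by positivity) ?_ 2
  linarith

instance (U : Set (Rn d)) : TopologicalSpace.SeparableSpace (H1 U) := by
  have : Fact ((2 : ℝ≥0∞) ≠ ⊤) := ⟨ENNReal.ofNat_ne_top⟩
  have h1 : SecondCountableTopology (Lp ℝ 2 (volume.restrict U)) := Lp.SecondCountableTopology
  have h2 : SecondCountableTopology (Lp (Rn d) 2 (volume.restrict U)) := Lp.SecondCountableTopology
  have h3 : SecondCountableTopology (GraphSpace U) := inferInstance
  infer_instance

theorem sq_norm_le_sum_ball (hΩ : IsOpen Ω) {t : Finset (Rn d)} {ρ : Rn d → ℝ}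
    (ht : Ω ⊆ ⋃ x ∈ t, Metric.ball x (ρ x)) (f : Lp ℝ 2 (volume.restrict Ω)) :
    ‖f‖ ^ 2 ≤ ∑ x ∈ t, ∫ y in Ω ∩ Metric.ball x (ρ x), f y ^ 2 := by
  have hi : Integrable (fun y => f y ^ 2) (volume.restrict Ω) := (Lp.memLp f).integrable_sq
  rw [sq_norm_eq_integral]
  simp only [Real.norm_eq_abs, sq_abs]
  calc ∫ y in Ω, f y ^ 2
      ≤ ∫ y in Ω, ∑ x ∈ t, (Metric.ball x (ρ x)).indicator (fun y => f y ^ 2) y := by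
        refine setIntegral_mono_on hi (integrable_finsetSum _ fun x _ =>
          hi.indicator Metric.isOpen_ball.measurableSet) hΩ.measurableSet fun y hy => ?_
        obtain ⟨x, hx, hyx⟩ := mem_iUnion₂.1 (ht hy)
        have h1 := Finset.single_le_sum (f := fun x =>
          (Metric.ball x (ρ x)).indicator (fun y => f y ^ 2) y)
          (fun x _ => indicator_nonneg (fun y _ => sq_nonneg _) y) hx
        simpa only [indicator_of_mem hyx] using h1
    _ = _ := by
        rw [integral_finsetSum _ fun x _ => hi.indicator Metric.isOpen_ball.measurableSet]
        refine Finset.sum_congr rfl fun x _ => ?_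
        rw [setIntegral_indicator Metric.isOpen_ball.measurableSet]

/-- The local result holds in a ball around each point of the compact closure; finitely many of
these balls cover `Ω`. -/
theorem tendsto_norm_valH1_of_weakly_null (hΩ : IsOpen Ω) (hb : Bornology.IsBounded Ω)
    (hlip : HasLipschitzBoundary Ω) {v : ℕ → H1 Ω} {M : ℝ} (hM : ∀ n, ‖v n‖ ≤ M)
    (hv : ∀ f : H1 Ω →L[ℝ] ℝ, Tendsto (fun n => f (v n)) atTop (𝓝 0)) :
    Tendsto (fun n => ‖valH1 (v n)‖) atTop (𝓝 0) := by
  have : IsFiniteMeasure (volume.restrict Ω) := ⟨by simpa using hb.measure_lt_top⟩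
  have hloc : ∀ x, ∃ ρ, x ∈ closure Ω → 0 < ρ ∧ Tendsto
      (fun n => ∫ y in Ω ∩ Metric.ball x ρ, valH1 (v n) y ^ 2) atTop (𝓝 0) := by
    intro x
    by_cases hx : x ∈ closure Ω
    · obtain ⟨e, κ, s, ρ, he, hκ, hκ1, hs, hρ, hcone⟩ := hlip.exists_cone hΩ hx
      exact ⟨ρ, fun _ => ⟨hρ, tendsto_integral_sq_of_cone hΩ (hΩ.inter Metric.isOpen_ball)
        inter_subset_left he hκ hκ1 hs hcone hM hv⟩⟩
    · exact ⟨0, fun h => absurd h hx⟩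
  choose ρ hρ using hloc
  obtain ⟨t, htΩ, htc⟩ := hb.isCompact_closure.elim_nhds_subcover (fun x => Metric.ball x (ρ x))
    fun x hx => Metric.ball_mem_nhds x (hρ x hx).1
  have hsum : Tendsto (fun n => ∑ x ∈ t, ∫ y in Ω ∩ Metric.ball x (ρ x), valH1 (v n) y ^ 2) atTop
      (𝓝 0) := by
    simpa only [Finset.sum_const_zero] using
      tendsto_finsetSum t fun x hx => (hρ x (htΩ x hx)).2
  have hsq : ∀ n, ‖valH1 (v n)‖ ^ 2 ≤
      ∑ x ∈ t, ∫ y in Ω ∩ Metric.ball x (ρ x), valH1 (v n) y ^ 2 :=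
    fun n => sq_norm_le_sum_ball hΩ (fun y hy => htc (subset_closure hy)) _
  have h1 : Tendsto (fun n => ‖valH1 (v n)‖ ^ 2) atTop (𝓝 0) :=
    squeeze_zero (fun n => sq_nonneg _) hsq hsum
  have h2 := h1.sqrt
  simpa only [Real.sqrt_zero, Real.sqrt_sq (norm_nonneg _)] using h2

set_option maxHeartbeats 800000 in
/-- **Rellich's theorem** for bounded Lipschitz domains. -/
theorem seqCompactMap_valL (hΩ : IsOpen Ω) (hb : Bornology.IsBounded Ω)
    (hlip : HasLipschitzBoundary Ω) : SeqCompactMap (valL Ω) := by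
  rintro u ⟨M, hM⟩
  obtain ⟨σ, hσ, u₀, hu₀⟩ := exists_weakly_convergent_subseq hM
  refine ⟨σ, hσ, ?_⟩
  have h1 := tendsto_norm_valH1_of_weakly_null hΩ hb hlip (v := fun n => u (σ n) - u₀)
    (fun n => (norm_sub_le _ _).trans (add_le_add_left (hM (σ n)) ‖u₀‖)) fun f => by
      have h2 := (hu₀ f).sub_const (f u₀)
      rw [sub_self] at h2
      exact h2.congr fun n => (f.map_sub _ _).symm
  have h3 : Tendsto (fun n => valL Ω (u (σ n))) atTop (𝓝 (valL Ω u₀)) :=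
    tendsto_iff_norm_sub_tendsto_zero.2 (h1.congr fun n => by rw [← map_sub]; rfl)
  exact h3.cauchySeq

end RellichCompactness

/-! ### Weighted forms and differentiability of simple Neumann eigenvalues. -/

section WeightedForms

open Filter
open LinearMap (BilinForm)

variable {d : ℕ} {Ω : Set (Rn d)} {F : Type*} [NormedAddCommGroup F] [InnerProductSpace ℝ F]

/-- Measurable and essentially bounded weights. -/
def IsWeight (Ω : Set (Rn d)) (κ : Rn d → ℝ) : Prop :=
  AEStronglyMeasurable κ (volume.restrict Ω) ∧ ∃ M, ∀ᵐ x ∂volume.restrict Ω, |κ x| ≤ M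

theorem IsWeight.integrable {κ : Rn d → ℝ} (hκ : IsWeight Ω κ)
    (u v : Lp F 2 (volume.restrict Ω)) :
    Integrable (fun x => κ x * ⟪u x, v x⟫) (volume.restrict Ω) := by
  obtain ⟨hm, M, hM⟩ := hκ
  exact (L2.integrable_inner u v).bdd_mul hm hM

theorem IsWeight.sub {κ κ' : Rn d → ℝ} (hκ : IsWeight Ω κ) (hκ' : IsWeight Ω κ') :
    IsWeight Ω fun x => κ x - κ' x := by
  obtain ⟨hm, M, hM⟩ := hκ
  obtain ⟨hm', M', hM'⟩ := hκ'
  refine ⟨hm.sub hm', M + M', ?_⟩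
  filter_upwards [hM, hM'] with x h1 h2
  exact (abs_sub _ _).trans (add_le_add h1 h2)

theorem IsWeight.const_mul {κ : Rn d → ℝ} (hκ : IsWeight Ω κ) (r : ℝ) :
    IsWeight Ω fun x => r * κ x := by
  obtain ⟨hm, M, hM⟩ := hκ
  refine ⟨hm.const_mul r, |r| * M, ?_⟩
  filter_upwards [hM] with x h1
  rw [abs_mul]
  gcongr

theorem wform_symm (κ : Rn d → ℝ) (u v : Rn d → F) : wform Ω κ u v = wform Ω κ v u := by
  simp only [wform, real_inner_comm]

theorem wform_add_left {κ : Rn d → ℝ} (hκ : IsWeight Ω κ)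
    (u v z : Lp F 2 (volume.restrict Ω)) :
    wform Ω κ (u + v : Lp F 2 (volume.restrict Ω)) z = wform Ω κ u z + wform Ω κ v z := by
  rw [wform, wform, wform, ← integral_add (hκ.integrable u z) (hκ.integrable v z)]
  refine integral_congr_ae ?_
  filter_upwards [Lp.coeFn_add u v] with x hx
  rw [hx, Pi.add_apply, inner_add_left, mul_add]

theorem wform_smul_left (κ : Rn d → ℝ) (r : ℝ) (u z : Lp F 2 (volume.restrict Ω)) :
    wform Ω κ (r • u : Lp F 2 (volume.restrict Ω)) z = r * wform Ω κ u z := by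
  rw [wform, wform, ← integral_const_mul]
  refine integral_congr_ae ?_
  filter_upwards [Lp.coeFn_smul r u] with x hx
  rw [hx, Pi.smul_apply, real_inner_smul_left]
  ring

theorem wform_sub_weight {κ κ' : Rn d → ℝ} (hκ : IsWeight Ω κ) (hκ' : IsWeight Ω κ')
    (u v : Lp F 2 (volume.restrict Ω)) :
    wform Ω (fun x => κ x - κ' x) u v = wform Ω κ u v - wform Ω κ' u v := by
  rw [wform, wform, wform, ← integral_sub (hκ.integrable u v) (hκ'.integrable u v)]
  simp only [sub_mul]

theorem wform_const_mul_weight (κ : Rn d → ℝ) (r : ℝ) (u v : Rn d → F) :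
    wform Ω (fun x => r * κ x) u v = r * wform Ω κ u v := by
  rw [wform, wform, ← integral_const_mul]
  simp only [mul_assoc]

theorem abs_wform_le {κ : Rn d → ℝ} {M : ℝ} (hM : ∀ᵐ x ∂volume.restrict Ω, |κ x| ≤ M)
    (hM0 : 0 ≤ M) (u v : Lp F 2 (volume.restrict Ω)) : |wform Ω κ u v| ≤ M * ‖u‖ * ‖v‖ := by
  have h1 : |wform Ω κ u v| ≤ ∫ x in Ω, M * (‖u x‖ * ‖v x‖) := by
    rw [wform, ← Real.norm_eq_abs]
    refine norm_integral_le_of_norm_le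
      (((Lp.memLp u).norm.integrable_mul (Lp.memLp v).norm).const_mul M) ?_
    filter_upwards [hM] with x hx
    rw [norm_mul]
    exact mul_le_mul hx (norm_inner_le_norm _ _) (norm_nonneg _) hM0
  have h2 := abs_integral_mul_le (Lp.memLp u).norm (Lp.memLp v).norm
  rw [← sq_norm_eq_integral, ← sq_norm_eq_integral, Real.sqrt_sq (norm_nonneg _),
    Real.sqrt_sq (norm_nonneg _)] at h2
  rw [integral_const_mul] at h1
  calc |wform Ω κ u v| ≤ M * ∫ x in Ω, ‖u x‖ * ‖v x‖ := h1
    _ ≤ M * (‖u‖ * ‖v‖) := by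
      refine mul_le_mul_of_nonneg_left ((le_abs_self _).trans h2) hM0
    _ = _ := by ring

theorem le_wform_self {κ : Rn d → ℝ} (hκ : IsWeight Ω κ) {C : ℝ}
    (hC : ∀ᵐ x ∂volume.restrict Ω, C ≤ κ x) (u : Lp F 2 (volume.restrict Ω)) :
    C * ‖u‖ ^ 2 ≤ wform Ω κ u u := by
  rw [sq_norm_eq_integral, ← integral_const_mul, wform]
  have h1 : Integrable (fun x => ‖u x‖ ^ 2) (volume.restrict Ω) := (Lp.memLp u).norm.integrable_sq
  refine integral_mono_ae (h1.const_mul C) (hκ.integrable u u) ?_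
  filter_upwards [hC] with x hx
  rw [real_inner_self_eq_norm_sq]
  gcongr

/-- The bound is relative to the form itself, as the min-max comparison of eigenvalues requires. -/
theorem abs_wform_sub_le {κ κ' : Rn d → ℝ} (hκ : IsWeight Ω κ) (hκ' : IsWeight Ω κ') {θ : ℝ}
    (hθ : ∀ᵐ x ∂volume.restrict Ω, |κ' x - κ x| ≤ θ * κ x) (u : Lp F 2 (volume.restrict Ω)) :
    |wform Ω κ' u u - wform Ω κ u u| ≤ θ * wform Ω κ u u := by
  rw [← wform_sub_weight hκ' hκ, ← wform_const_mul_weight, wform, wform, ← Real.norm_eq_abs]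
  refine norm_integral_le_of_norm_le ((hκ.const_mul θ).integrable u u) ?_
  filter_upwards [hθ] with x hx
  rw [norm_mul, Real.norm_of_nonneg real_inner_self_nonneg]
  exact mul_le_mul_of_nonneg_right hx real_inner_self_nonneg

/-- The weighted form on `L²` as a bilinear form. -/
noncomputable def weightedForm {κ : Rn d → ℝ} (hκ : IsWeight Ω κ) :
    BilinForm ℝ (Lp F 2 (volume.restrict Ω)) :=
  LinearMap.mk₂ ℝ (fun u v => wform Ω κ u v) (wform_add_left hκ) (wform_smul_left κ)
    (fun u v z => by
      rw [wform_symm, wform_add_left hκ, wform_symm κ v, wform_symm κ z])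
    (fun r u v => by rw [wform_symm, wform_smul_left, wform_symm, smul_eq_mul])

section Pullback

variable {H : Type*} [NormedAddCommGroup H] [InnerProductSpace ℝ H]

/-- The form `(Tu, Tv)_κ` for an operator `T` with values in `L²`. -/
noncomputable def pullbackForm (T : H →L[ℝ] Lp F 2 (volume.restrict Ω)) {κ : Rn d → ℝ}
    (hκ : IsWeight Ω κ) : BilinForm ℝ H :=
  (weightedForm hκ).compl₁₂ T.toLinearMap T.toLinearMap

theorem pullbackForm_apply (T : H →L[ℝ] Lp F 2 (volume.restrict Ω)) {κ : Rn d → ℝ}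
    (hκ : IsWeight Ω κ) (u v : H) : pullbackForm T hκ u v = wform Ω κ (T u) (T v) := rfl

theorem IsWeight.exists_bound {κ : Rn d → ℝ} (hκ : IsWeight Ω κ) :
    ∃ M, 0 ≤ M ∧ ∀ᵐ x ∂volume.restrict Ω, |κ x| ≤ M := by
  obtain ⟨-, M, hM⟩ := hκ
  exact ⟨|M|, abs_nonneg M, hM.mono fun x hx => hx.trans (le_abs_self M)⟩

theorem isFormPair_pullbackForm {F' : Type*} [NormedAddCommGroup F'] [InnerProductSpace ℝ F']
    {V : H →L[ℝ] Lp F 2 (volume.restrict Ω)} {G : H →L[ℝ] Lp F' 2 (volume.restrict Ω)}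
    (hVG : ∀ u, ‖u‖ ^ 2 = ‖V u‖ ^ 2 + ‖G u‖ ^ 2) (hV : ∀ u, V u = 0 → u = 0)
    {κ κ' : Rn d → ℝ} (hκ : IsWeight Ω κ)
    (hκ' : IsWeight Ω κ') {C : ℝ} (hC : 0 < C) (h : ∀ x, C ≤ κ x) (h' : ∀ x, C ≤ κ' x) :
    IsFormPair V (pullbackForm G hκ) (pullbackForm V hκ') where
  symm_left u v := wform_symm _ _ _
  symm_right u v := wform_symm _ _ _
  nonneg u := by
    rw [pullbackForm_apply]
    exact (by positivity : 0 ≤ C * ‖G u‖ ^ 2).trans (le_wform_self hκ (.of_forall h) _)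
  pos u hu := by
    have h1 : 0 < ‖V u‖ := norm_pos_iff.2 fun h0 => hu (hV u h0)
    rw [pullbackForm_apply]
    exact (mul_pos hC (pow_pos h1 2)).trans_le (le_wform_self hκ' (.of_forall h') _)
  bound_left := by
    obtain ⟨M, hM0, hM⟩ := hκ.exists_bound
    have hG : ∀ u, ‖G u‖ ≤ ‖u‖ := fun u =>
      le_of_sq_le_sq (by rw [hVG]; nlinarith [sq_nonneg ‖V u‖]) (norm_nonneg _)
    refine ⟨M, fun u v => ?_⟩
    rw [pullbackForm_apply]
    refine (abs_wform_le hM hM0 _ _).trans ?_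
    gcongr
    · exact hG u
    · exact hG v
  bound_right := by
    obtain ⟨M, hM0, hM⟩ := hκ'.exists_bound
    exact ⟨M, hM0, fun u v => abs_wform_le hM hM0 _ _⟩
  coercive := by
    refine ⟨C, hC, fun u => ?_⟩
    have h1 := le_wform_self hκ (.of_forall h) (G u)
    have h2 := le_wform_self hκ' (.of_forall h') (V u)
    rw [pullbackForm_apply, pullbackForm_apply, hVG]
    linarith

end Pullback

/-- The form `(∇u, ∇v)_κ` on `H¹(Ω)`. -/
noncomputable def gradForm {κ : Rn d → ℝ} (hκ : IsWeight Ω κ) : BilinForm ℝ (H1 Ω) :=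
  pullbackForm (gradL Ω) hκ

/-- The form `(u, v)_κ` on `H¹(Ω)`. -/
noncomputable def valForm {κ : Rn d → ℝ} (hκ : IsWeight Ω κ) : BilinForm ℝ (H1 Ω) :=
  pullbackForm (valL Ω) hκ

theorem gradForm_apply {κ : Rn d → ℝ} (hκ : IsWeight Ω κ) (u v : H1 Ω) :
    gradForm hκ u v = wform Ω κ (gradH1 u) (gradH1 v) := rfl

theorem valForm_apply {κ : Rn d → ℝ} (hκ : IsWeight Ω κ) (u v : H1 Ω) :
    valForm hκ u v = wform Ω κ (valH1 u) (valH1 v) := rfl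

theorem abs_gradForm_le {κ : Rn d → ℝ} {M : ℝ}
    (hM : ∀ᵐ x ∂volume.restrict Ω, |κ x| ≤ M) (hM0 : 0 ≤ M) (u v : H1 Ω) :
    |wform Ω κ (gradH1 u) (gradH1 v)| ≤ M * ‖u‖ * ‖v‖ := by
  refine (abs_wform_le hM hM0 _ _).trans ?_
  gcongr
  · exact norm_gradH1_le u
  · exact norm_gradH1_le v

theorem abs_valForm_le {κ : Rn d → ℝ} {M : ℝ}
    (hM : ∀ᵐ x ∂volume.restrict Ω, |κ x| ≤ M) (hM0 : 0 ≤ M) (u v : H1 Ω) :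
    |wform Ω κ (valH1 u) (valH1 v)| ≤ M * ‖u‖ * ‖v‖ := by
  refine (abs_wform_le hM hM0 _ _).trans ?_
  gcongr
  · exact norm_valH1_le u
  · exact norm_valH1_le v

theorem wform_valH1_self_pos (hΩ : IsOpen Ω) {κ : Rn d → ℝ} (hκ : IsWeight Ω κ) {C : ℝ}
    (hC : 0 < C) (h : ∀ x, C ≤ κ x) {u : H1 Ω} (hu : u ≠ 0) :
    0 < wform Ω κ (valH1 u) (valH1 u) := by
  have h1 : 0 < ‖valH1 u‖ := norm_pos_iff.2 fun h0 => hu (H1_eq_zero_of_valH1_eq_zero hΩ h0)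
  exact (mul_pos hC (pow_pos h1 2)).trans_le (le_wform_self hκ (.of_forall h) _)

theorem isFormPair_of_weights (hΩ : IsOpen Ω) {κ κ' : Rn d → ℝ} (hκ : IsWeight Ω κ)
    (hκ' : IsWeight Ω κ') {C : ℝ} (hC : 0 < C) (h : ∀ x, C ≤ κ x) (h' : ∀ x, C ≤ κ' x) :
    IsFormPair (valL Ω) (gradForm hκ) (valForm hκ') :=
  isFormPair_pullbackForm (V := valL Ω) (G := gradL Ω) sq_norm_H1
    (fun _ => H1_eq_zero_of_valH1_eq_zero hΩ) hκ hκ' hC h h'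

theorem ae_abs_le_norm (φ : LInf Ω) : ∀ᵐ x ∂volume.restrict Ω, |φ x| ≤ ‖φ‖ := by
  filter_upwards [ae_le_eLpNormEssSup (f := φ) (μ := volume.restrict Ω)] with x hx
  rw [← eLpNorm_exponent_top, ← Lp.enorm_def] at hx
  exact (enorm_le_iff_norm_le).1 hx

theorem isWeight_comp {f : ℝ → ℝ} (hf : Continuous f) (φ : LInf Ω) :
    IsWeight Ω fun x => f (φ x) := by
  refine ⟨hf.comp_aestronglyMeasurable (Lp.aestronglyMeasurable φ), ?_⟩
  obtain ⟨M, hM⟩ := (isCompact_Icc (a := -‖φ‖) (b := ‖φ‖)).exists_bound_of_continuousOn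
    hf.continuousOn
  exact ⟨M, (ae_abs_le_norm φ).mono fun x hx => hM _ (abs_le.1 hx)⟩

theorem IsWeight.mul {κ κ' : Rn d → ℝ} (hκ : IsWeight Ω κ) (hκ' : IsWeight Ω κ') :
    IsWeight Ω fun x => κ x * κ' x := by
  obtain ⟨M, hM0, hM⟩ := hκ.exists_bound
  obtain ⟨M', -, hM'⟩ := hκ'.exists_bound
  refine ⟨hκ.1.mul hκ'.1, M * M', ?_⟩
  filter_upwards [hM, hM'] with x h1 h2
  rw [abs_mul]
  gcongr

theorem C11Loc.continuous {f : ℝ → ℝ} (hf : C11Loc f) : Continuous f := hf.1.continuous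

theorem C11Loc.continuous_deriv {f : ℝ → ℝ} (hf : C11Loc f) : Continuous (deriv f) :=
  hf.1.continuous_deriv le_rfl

/-- Uniform first order expansion of a `C^{1,1}_loc` function on bounded sets. -/
theorem C11Loc.exists_expansion {f : ℝ → ℝ} (hf : C11Loc f) (R : ℝ) :
    ∃ K, 0 ≤ K ∧ ∀ s k, |s| ≤ R → |s + k| ≤ R →
      |f (s + k) - f s - deriv f s * k| ≤ K * k ^ 2 := by
  obtain ⟨K, hK⟩ := hf.2.locallyLipschitzOn.exists_lipschitzOnWith_of_compact
    (isCompact_Icc (a := -R) (b := R))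
  refine ⟨K, K.2, fun s k hs hsk => ?_⟩
  have hs' := abs_le.1 hs
  have hsk' := abs_le.1 hsk
  have hseg : uIcc s (s + k) ⊆ Icc (-R) R := uIcc_subset_Icc hs' hsk'
  -- Mean value inequality for `f` minus its linear part at `s`, whose derivative is at most `K |k|`
  -- on the segment by the Lipschitz bound.
  have h1 := (convex_uIcc s (s + k)).norm_image_sub_le_of_norm_hasDerivWithin_le
    (f := fun y => f y - deriv f s * y) (f' := fun y => deriv f y - deriv f s) (C := K * |k|)
    (fun y _ => by
      have h2 := (hf.1.differentiable (by simp) y).hasDerivAt.hasDerivWithinAt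
        (s := uIcc s (s + k))
      have h3 := (hasDerivWithinAt_id y (uIcc s (s + k))).const_mul (deriv f s)
      have h4 := h2.sub h3
      simp only [mul_one] at h4
      exact h4)
    (fun y hy => by
      have h2 := hK.dist_le_mul y (hseg hy) s hs'
      rw [Real.dist_eq, Real.dist_eq] at h2
      have h3 : |y - s| ≤ |k| := by simpa using abs_sub_left_of_mem_uIcc hy
      exact h2.trans (by gcongr))
    left_mem_uIcc right_mem_uIcc
  rw [Real.norm_eq_abs, Real.norm_eq_abs, add_sub_cancel_left, mul_assoc, ← abs_mul, ← sq,
    abs_of_nonneg (sq_nonneg k)] at h1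
  refine le_of_eq_of_le ?_ h1
  congr 1
  ring

theorem coeFn_add_smul (φ h : LInf Ω) (t : ℝ) :
    ⇑(φ + t • h) =ᵐ[volume.restrict Ω] fun x => φ x + t * h x := by
  filter_upwards [Lp.coeFn_add φ (t • h), Lp.coeFn_smul t h] with x h1 h2
  rw [h1, Pi.add_apply, h2, Pi.smul_apply, smul_eq_mul]

/-- First order expansion of a superposition operator in `L^∞`. -/
theorem C11Loc.exists_expansion_comp {f : ℝ → ℝ} (hf : C11Loc f) (φ h : LInf Ω) :
    ∃ K, 0 ≤ K ∧ ∀ t : ℝ, |t| ≤ 1 → ∀ᵐ x ∂volume.restrict Ω,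
      |f ((φ + t • h : LInf Ω) x) - f (φ x) - t * (deriv f (φ x) * h x)| ≤ |t| * (K * |t|) := by
  obtain ⟨K, hK0, hK⟩ := hf.exists_expansion (‖φ‖ + ‖h‖)
  refine ⟨K * ‖h‖ ^ 2, by positivity, fun t ht => ?_⟩
  filter_upwards [coeFn_add_smul φ h t, ae_abs_le_norm φ, ae_abs_le_norm h] with x h1 h2 h3
  have h4 : |t * h x| ≤ ‖h‖ := by
    rw [abs_mul]
    exact (mul_le_of_le_one_left (abs_nonneg _) ht).trans h3
  have h5 := hK (φ x) (t * h x) (h2.trans (by linarith [norm_nonneg h]))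
    ((abs_add_le _ _).trans (add_le_add h2 h4))
  rw [h1]
  have h6 : t * (deriv f (φ x) * h x) = deriv f (φ x) * (t * h x) := by ring
  rw [h6]
  refine h5.trans ?_
  have h7 : (h x) ^ 2 ≤ ‖h‖ ^ 2 := sq_le_sq.2 (by rwa [abs_of_nonneg (norm_nonneg h)])
  calc K * (t * h x) ^ 2 = K * t ^ 2 * (h x) ^ 2 := by ring
    _ ≤ K * t ^ 2 * ‖h‖ ^ 2 := by gcongr
    _ = |t| * (K * ‖h‖ ^ 2 * |t|) := by rw [← sq_abs t]; ring

/-- Relative and first order bounds for a positive coefficient along a line in `L^∞`. -/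
theorem exists_coefficient_expansion {a : ℝ → ℝ} (ha : C11Loc a) {C : ℝ} (hC : 0 < C)
    (haC : ∀ s, C ≤ a s) (φ h : LInf Ω) :
    ∃ K, 0 ≤ K ∧ ∀ t : ℝ, |t| ≤ 1 →
      (∀ᵐ x ∂volume.restrict Ω, |a ((φ + t • h : LInf Ω) x) - a (φ x)| ≤ K * |t| * a (φ x)) ∧
      ∀ᵐ x ∂volume.restrict Ω,
        |a ((φ + t • h : LInf Ω) x) - a (φ x) - t * (deriv a (φ x) * h x)| ≤ |t| * (K * |t|) := by
  obtain ⟨K, hK0, hK⟩ := ha.exists_expansion_comp φ h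
  obtain ⟨D, hD0, hD⟩ := ((isWeight_comp ha.continuous_deriv φ).mul
    (isWeight_comp continuous_id h)).exists_bound
  -- The summand `(K + D) / C` serves the relative bound, using `C ≤ a`; the summand `K` serves the
  -- first-order remainder.
  refine ⟨K + (K + D) / C, by positivity, fun t ht => ⟨?_, ?_⟩⟩
  · filter_upwards [hK t ht, hD] with x h1 h2
    simp only [id] at h2
    have h3 : |a ((φ + t • h : LInf Ω) x) - a (φ x)| ≤ |t| * (K * |t|) + |t| * D := by
      calc _ = |(a ((φ + t • h : LInf Ω) x) - a (φ x) - t * (deriv a (φ x) * h x))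
            + t * (deriv a (φ x) * h x)| := by ring_nf
        _ ≤ _ := by
          refine (abs_add_le _ _).trans ?_
          rw [abs_mul t]
          gcongr
    have h4 : |t| * (K * |t|) ≤ |t| * (K * 1) := by gcongr
    calc _ ≤ |t| * (K + D) := by linarith
      _ = (K + D) / C * |t| * C := by field_simp
      _ ≤ (K + (K + D) / C) * |t| * a (φ x) := by
        gcongr
        · linarith
        · exact haC _
  · filter_upwards [hK t ht] with x h1
    refine h1.trans ?_
    have : 0 ≤ (K + D) / C := by positivity
    gcongr
    linarith

/-- Simple Neumann eigenvalues are differentiable along lines in `L^∞(Ω)`. -/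
theorem tendsto_slope_neumannEigenvalue (hd : 1 ≤ d) (hΩ : IsOpen Ω)
    (hb : Bornology.IsBounded Ω) (hne : Ω.Nonempty) (hlip : HasLipschitzBoundary Ω)
    {a c : ℝ → ℝ} (ha : C11Loc a) (hc : C11Loc c) {C : ℝ} (hC : 0 < C) (haC : ∀ s, C ≤ a s)
    (hcC : ∀ s, C ≤ c s) (φ h : LInf Ω) {t : ℕ → ℝ} (ht : Tendsto t atTop (𝓝 0))
    (ht0 : ∀ n, t n ≠ 0) (ht1 : ∀ n, |t n| ≤ 1) {k : ℕ} {w : H1 Ω}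
    (hw : IsWeakNeumannSolution Ω a c φ (neumannEigenvalue Ω a c φ k) w)
    (hw1 : wform Ω (fun x => c (φ x)) (valH1 w) (valH1 w) = 1)
    (hsimple : ∀ v : H1 Ω, IsWeakNeumannSolution Ω a c φ (neumannEigenvalue Ω a c φ k) v →
      ∃ ξ : ℝ, v = ξ • w) :
    Tendsto (fun n => (t n)⁻¹ *
        (neumannEigenvalue Ω a c (φ + t n • h) k - neumannEigenvalue Ω a c φ k)) atTop
      (𝓝 (wform Ω (fun x => deriv a (φ x) * h x) (gradH1 w) (gradH1 w)
        - neumannEigenvalue Ω a c φ k *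
          wform Ω (fun x => deriv c (φ x) * h x) (valH1 w) (valH1 w))) := by
  have hpair : ∀ ϑ : LInf Ω, IsFormPair (valL Ω) (gradForm (isWeight_comp ha.continuous ϑ))
      (valForm (isWeight_comp hc.continuous ϑ)) := fun ϑ =>
    isFormPair_of_weights hΩ _ _ hC (fun x => haC _) (fun x => hcC _)
  have hwt : ∀ {f : ℝ → ℝ}, C11Loc f → IsWeight Ω fun x => deriv f (φ x) * h x := fun hf =>
    (isWeight_comp hf.continuous_deriv φ).mul (isWeight_comp continuous_id h)
  obtain ⟨Ka, hKa0, hKa⟩ := exists_coefficient_expansion ha hC haC φ h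
  obtain ⟨Kc, hKc0, hKc⟩ := exists_coefficient_expansion hc hC hcC φ h
  obtain ⟨Ma, hMa0, hMa⟩ := (hwt ha).exists_bound
  obtain ⟨Mc, hMc0, hMc⟩ := (hwt hc).exists_bound
  have hθ : Tendsto (fun n => (Ka + Kc) * |t n|) atTop (𝓝 0) := by
    simpa using ht.abs.const_mul (Ka + Kc)
  -- The first-order remainder of a weighted form is the form weighted by the pointwise remainder,
  -- so `L^∞` bounds on coefficients become bounds on forms.
  have haux : ∀ {f : ℝ → ℝ} (hf : C11Loc f) (n : ℕ) {G : Type} [NormedAddCommGroup G]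
      [InnerProductSpace ℝ G] (u v : Lp G 2 (volume.restrict Ω)),
      wform Ω (fun x => f ((φ + t n • h : LInf Ω) x)) u v - wform Ω (fun x => f (φ x)) u v
        - t n * wform Ω (fun x => deriv f (φ x) * h x) u v
      = wform Ω (fun x => f ((φ + t n • h : LInf Ω) x) - f (φ x)
        - t n * (deriv f (φ x) * h x)) u v := by
    intro f hf n G _ _ u v
    rw [wform_sub_weight ((isWeight_comp hf.continuous _).sub (isWeight_comp hf.continuous _))
      ((hwt hf).const_mul _), wform_const_mul_weight,
      wform_sub_weight (isWeight_comp hf.continuous _) (isWeight_comp hf.continuous _)]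
  have hKle : ∀ n, Ka * |t n| ≤ (Ka + Kc) * |t n| := fun n => by gcongr; linarith
  have hKle' : ∀ n, Kc * |t n| ≤ (Ka + Kc) * |t n| := fun n => by gcongr; linarith
  -- `neumannEigenvalue` unfolds to `formEigenvalue` of the gradient and value forms, so the
  -- hypotheses on `w` pass over unchanged.
  refine (hpair φ).tendsto_slope_formEigenvalue (A' := gradForm (hwt ha)) (C' := valForm (hwt hc))
    (fun n => hpair (φ + t n • h)) (seqCompactMap_valL hΩ hb hlip)
    (not_finiteDimensional_H1 hd hΩ hb hne) hθ (fun n => by positivity) ht ht0 ?_ ?_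
    ⟨Ma, abs_gradForm_le hMa hMa0⟩ ⟨Mc, abs_valForm_le hMc hMc0⟩ ?_ ?_ hw hw1 hsimple
  · intro n v
    refine (abs_wform_sub_le (isWeight_comp ha.continuous φ) (isWeight_comp ha.continuous _)
      (hKa _ (ht1 n)).1 _).trans ?_
    exact mul_le_mul_of_nonneg_right (hKle n) ((hpair φ).nonneg v)
  · intro n v
    refine (abs_wform_sub_le (isWeight_comp hc.continuous φ) (isWeight_comp hc.continuous _)
      (hKc _ (ht1 n)).1 _).trans ?_
    refine mul_le_mul_of_nonneg_right (hKle' n) ?_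
    exact (by positivity : 0 ≤ C * ‖valH1 v‖ ^ 2).trans
      (le_wform_self (isWeight_comp hc.continuous φ) (.of_forall fun x => hcC _) _)
  · intro n u v
    simp only [gradForm_apply]
    rw [haux ha]
    refine (abs_gradForm_le (hKa _ (ht1 n)).2 (by positivity) u v).trans ?_
    have := hKle n
    gcongr
  · intro n u v
    simp only [valForm_apply]
    rw [haux hc]
    refine (abs_valForm_le (hKc _ (ht1 n)).2 (by positivity) u v).trans ?_
    have := hKle' n
    gcongr

/-- Simple Neumann eigenvalues with positive index are positive. -/
theorem neumannEigenvalue_pos (hd : 1 ≤ d) (hΩ : IsOpen Ω)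
    (hb : Bornology.IsBounded Ω) (hne : Ω.Nonempty) (hlip : HasLipschitzBoundary Ω)
    {a c : ℝ → ℝ} (ha : Continuous a) (hc : Continuous c) {C : ℝ} (hC : 0 < C)
    (haC : ∀ s, C ≤ a s) (hcC : ∀ s, C ≤ c s) (φ : LInf Ω) {k : ℕ} (hk : 0 < k)
    (hsimple : IsSimpleEigenvalue Ω a c φ (neumannEigenvalue Ω a c φ k)) :
    0 < neumannEigenvalue Ω a c φ k := by
  obtain ⟨w, -, hw⟩ := hsimple
  exact (isFormPair_of_weights hΩ (isWeight_comp ha φ) (isWeight_comp hc φ) hC (fun x => haC _)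
    (fun x => hcC _)).formEigenvalue_pos (seqCompactMap_valL hΩ hb hlip)
    (not_finiteDimensional_H1 hd hΩ hb hne) hk hw

/-- Eigenfunctions to nonzero eigenvalues have weighted mean zero. -/
theorem IsWeakNeumannSolution.mem_H1Mean (hΩ : IsOpen Ω) (hb : Bornology.IsBounded Ω)
    {a c : ℝ → ℝ} {φ : LInf Ω} {μ : ℝ} (hμ : μ ≠ 0) {w : H1 Ω}
    (hw : IsWeakNeumannSolution Ω a c φ μ w) : w ∈ H1Mean Ω c φ := by
  -- The constant function `1` is the test element: its weak gradient vanishes, so the equation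
  -- reduces to `μ` times the weighted mean of `w`.
  obtain ⟨o, ho⟩ := exists_H1_of_contDiff hΩ hb (u := fun _ => (1 : ℝ)) contDiff_const
  have hgrad : gradH1 o = 0 := by
    refine eq_zero_of_hasWeakGradient_zero hΩ fun ζ hζ hc hs v => ?_
    have h1 := o.2 ζ hζ hc hs v
    change ∫ x in Ω, valH1 o x * fderiv ℝ ζ x v = - ∫ x in Ω, ⟪gradH1 o x, v⟫ * ζ x at h1
    rw [← h1]
    have h2 : ∫ x in Ω, valH1 o x * fderiv ℝ ζ x v = ∫ x in Ω, 1 * fderiv ℝ ζ x v := by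
      refine integral_congr_ae ?_
      filter_upwards [ho] with x hx
      rw [hx]
    have hz' : ∀ x ∉ Ω, 1 * fderiv ℝ ζ x v = 0 := fun x hx => by
      have : x ∉ tsupport (fderiv ℝ ζ) := fun h => hx (hs (tsupport_fderiv_subset ℝ h))
      rw [image_eq_zero_of_notMem_tsupport this]
      simp
    have hfd : Continuous fun x => fderiv ℝ ζ x v :=
      (hζ.continuous_fderiv (by simp)).clm_apply continuous_const
    have h3 : ∫ x, (1 : ℝ) * fderiv ℝ ζ x v = - ∫ x, fderiv ℝ (fun _ => (1 : ℝ)) x v * ζ x := by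
      refine integral_mul_fderiv_eq_neg_fderiv_mul_of_integrable ?_ ?_ ?_ ?_ ?_
      · simp
      · simpa using hfd.integrable_of_hasCompactSupport (hc.fderiv_apply ℝ v)
      · simpa using hζ.continuous.integrable_of_hasCompactSupport hc
      · exact fun x _ => differentiableAt_const _
      · exact fun x _ => hζ.differentiable (by simp) x
    rw [h2, setIntegral_eq_integral_of_forall_compl_eq_zero hz', h3]
    simp
  have h1 := hw o
  have h2 : wform Ω (fun x => a (φ x)) (gradH1 w) (gradH1 o) = 0 := by
    rw [wform, hgrad]
    refine integral_eq_zero_of_ae ?_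
    filter_upwards [Lp.coeFn_zero (Rn d) 2 (volume.restrict Ω)] with x hx
    rw [hx]
    simp
  rw [h2, eq_comm, mul_eq_zero, or_iff_right hμ] at h1
  change ∫ x in Ω, c (φ x) * valH1 w x = 0
  rw [← h1]
  refine integral_congr_ae ?_
  filter_upwards [ho] with x hx
  simp [hx]

theorem exists_isNormalizedEigenfunction (hΩ : IsOpen Ω) (hb : Bornology.IsBounded Ω)
    {a c : ℝ → ℝ} (hc : Continuous c) {C : ℝ} (hC : 0 < C) (hcC : ∀ s, C ≤ c s) {φ : LInf Ω}
    {μ : ℝ} (hμ : μ ≠ 0) {w : H1 Ω} (hw : IsEigenfunction Ω a c φ μ w) :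
    ∃ w, IsNormalizedEigenfunction Ω a c φ μ w := by
  have hκ := isWeight_comp hc φ
  have hpos : 0 < wform Ω (fun x => c (φ x)) (valH1 w) (valH1 w) :=
    wform_valH1_self_pos hΩ hκ hC (fun x => hcC _) hw.1
  set m := wform Ω (fun x => c (φ x)) (valH1 w) (valH1 w) with hm
  have hs : 0 < √m := Real.sqrt_pos.2 hpos
  have hsol : IsWeakNeumannSolution Ω a c φ μ ((√m)⁻¹ • w) := by
    intro η
    have h1 := hw.2 η
    change wform Ω _ ((√m)⁻¹ • gradH1 w : Lp (Rn d) 2 (volume.restrict Ω)) (gradH1 η)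
      = μ * wform Ω _ ((√m)⁻¹ • valH1 w : Lp ℝ 2 (volume.restrict Ω)) (valH1 η)
    rw [wform_smul_left, wform_smul_left, h1]
    ring
  refine ⟨(√m)⁻¹ • w, hsol.mem_H1Mean hΩ hb hμ, ⟨smul_ne_zero (inv_ne_zero hs.ne') hw.1, hsol⟩, ?_⟩
  change wform Ω _ ((√m)⁻¹ • valH1 w : Lp ℝ 2 (volume.restrict Ω))
    ((√m)⁻¹ • valH1 w : Lp ℝ 2 (volume.restrict Ω)) = 1
  rw [wform_smul_left, wform_symm, wform_smul_left, ← hm, ← mul_assoc, ← mul_inv,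
    Real.mul_self_sqrt hpos.le, inv_mul_cancel₀ hpos.ne']

end WeightedForms

/-! ### Derivative of the energy, convexity of the constraints and the first-order condition. -/

section Energy

open Filter

variable {d : ℕ} {Ω U : Set (Rn d)}

theorem ae_restrict_of_subset {X : Type*} [MeasurableSpace X] {μ : Measure X} {s t : Set X}
    (h : s ⊆ t) {p : X → Prop} (hp : ∀ᵐ x ∂μ.restrict t, p x) : ∀ᵐ x ∂μ.restrict s, p x :=
  ae_mono (Measure.restrict_mono h le_rfl) hp

theorem weakGrad_eq (hU : IsOpen U) {u : Rn d → ℝ} {w : H1 U}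
    (h : u =ᵐ[volume.restrict U] valH1 w) : weakGrad U u = gradH1 w := by
  have hm : MemH1 U u := ⟨w, h⟩
  rw [weakGrad, dif_pos hm]
  congr 1
  exact H1_ext hU (Lp.ext (hm.choose_spec.symm.trans h))

theorem MemH1.sub (hUΩ : U ⊆ Ω) {φ ϑ : LInf Ω} (hφ : MemH1 U φ) (hϑ : MemH1 U ϑ) :
    MemH1 U (φ - ϑ : LInf Ω) := by
  obtain ⟨w, hw⟩ := hφ
  obtain ⟨z, hz⟩ := hϑ
  refine ⟨w - z, ?_⟩
  filter_upwards [ae_restrict_of_subset hUΩ (Lp.coeFn_sub φ ϑ), Lp.coeFn_sub (valH1 w) (valH1 z),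
    hw, hz] with x h1 h2 h3 h4
  change _ = (valH1 w - valH1 z : Lp ℝ 2 (volume.restrict U)) x
  rw [h1, h2, Pi.sub_apply, Pi.sub_apply, h3, h4]

theorem exists_H1_add_smul (hUΩ : U ⊆ Ω) {φ h : LInf Ω} {w z : H1 U}
    (hw : φ =ᵐ[volume.restrict U] valH1 w) (hz : h =ᵐ[volume.restrict U] valH1 z) (t : ℝ) :
    (φ + t • h : LInf Ω) =ᵐ[volume.restrict U] valH1 (w + t • z) := by
  filter_upwards [ae_restrict_of_subset hUΩ (coeFn_add_smul φ h t),
    Lp.coeFn_add (valH1 w) (t • valH1 z), Lp.coeFn_smul t (valH1 z), hw, hz] with x h1 h2 h3 h4 h5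
  change _ = (valH1 w + t • valH1 z : Lp ℝ 2 (volume.restrict U)) x
  rw [h1, h2, Pi.add_apply, h3, Pi.smul_apply, h4, h5, smul_eq_mul]

theorem MemH1.add_smul (hUΩ : U ⊆ Ω) {φ h : LInf Ω} (hφ : MemH1 U φ) (hh : MemH1 U h) (t : ℝ) :
    MemH1 U (φ + t • h : LInf Ω) := by
  obtain ⟨w, hw⟩ := hφ
  obtain ⟨z, hz⟩ := hh
  exact ⟨_, exists_H1_add_smul hUΩ hw hz t⟩

theorem weakGrad_add_smul (hU : IsOpen U) (hUΩ : U ⊆ Ω) {φ h : LInf Ω} (hφ : MemH1 U φ)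
    (hh : MemH1 U h) (t : ℝ) :
    weakGrad U (φ + t • h : LInf Ω) = weakGrad U φ + t • weakGrad U h := by
  obtain ⟨w, hw⟩ := hφ
  obtain ⟨z, hz⟩ := hh
  rw [weakGrad_eq hU hw, weakGrad_eq hU hz, weakGrad_eq hU (exists_H1_add_smul hUΩ hw hz t)]
  rfl

theorem integrable_of_isWeight (hUΩ : U ⊆ Ω) (hU : volume U ≠ ⊤) {κ : Rn d → ℝ}
    (hκ : IsWeight Ω κ) : Integrable κ (volume.restrict U) := by
  have : IsFiniteMeasure (volume.restrict U) := ⟨by simpa using hU.lt_top⟩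
  obtain ⟨hm, M, hM⟩ := hκ
  exact Integrable.of_bound (hm.mono_measure (Measure.restrict_mono hUΩ le_rfl)) M
    (ae_restrict_of_subset hUΩ hM)

theorem isWeight_coeFn (φ : LInf Ω) : IsWeight Ω φ := isWeight_comp continuous_id φ

/-- The derivative of `φ ↦ ∫ ψ(φ)` along a line in `L^∞`. -/
theorem tendsto_slope_integral_comp (hUΩ : U ⊆ Ω) (hU : volume U ≠ ⊤) {ψ : ℝ → ℝ} (hψ : C11Loc ψ)
    (φ h : LInf Ω) {t : ℕ → ℝ} (ht : Tendsto t atTop (𝓝 0)) (ht0 : ∀ n, t n ≠ 0)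
    (ht1 : ∀ n, |t n| ≤ 1) :
    Tendsto (fun n => (t n)⁻¹ * ((∫ x in U, ψ ((φ + t n • h : LInf Ω) x)) - ∫ x in U, ψ (φ x)))
      atTop (𝓝 (∫ x in U, deriv ψ (φ x) * h x)) := by
  have : IsFiniteMeasure (volume.restrict U) := ⟨by simpa using hU.lt_top⟩
  obtain ⟨K, hK0, hK⟩ := hψ.exists_expansion_comp φ h
  have hi : ∀ ϑ : LInf Ω, Integrable (fun x => ψ (ϑ x)) (volume.restrict U) := fun ϑ =>
    integrable_of_isWeight hUΩ hU (isWeight_comp hψ.continuous ϑ)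
  have hi' : Integrable (fun x => deriv ψ (φ x) * h x) (volume.restrict U) :=
    integrable_of_isWeight hUΩ hU
      ((isWeight_comp hψ.continuous_deriv φ).mul (isWeight_coeFn h))
  rw [tendsto_iff_norm_sub_tendsto_zero]
  refine squeeze_zero (g := fun n => K * volume.real U * |t n|) (fun _ => norm_nonneg _)
    (fun n => ?_) (by simpa using ht.abs.const_mul (K * volume.real U))
  have h1 : (∫ x in U, (ψ ((φ + t n • h : LInf Ω) x) - ψ (φ x) - t n * (deriv ψ (φ x) * h x)))
      = (∫ x in U, ψ ((φ + t n • h : LInf Ω) x)) - (∫ x in U, ψ (φ x))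
        - t n * ∫ x in U, deriv ψ (φ x) * h x := by
    have hs : Integrable (fun x => ψ ((φ + t n • h : LInf Ω) x) - ψ (φ x)) (volume.restrict U) :=
      (hi _).sub (hi φ)
    rw [integral_sub hs (hi'.const_mul _), integral_sub (hi _) (hi φ), integral_const_mul]
  have h2 := norm_integral_le_of_norm_le_const (μ := volume.restrict U)
    (f := fun x => ψ ((φ + t n • h : LInf Ω) x) - ψ (φ x) - t n * (deriv ψ (φ x) * h x))
    (ae_restrict_of_subset hUΩ (hK (t n) (ht1 n)))
  rw [h1, measureReal_restrict_apply_univ] at h2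
  have h3 : (t n)⁻¹ * ((∫ x in U, ψ ((φ + t n • h : LInf Ω) x)) - ∫ x in U, ψ (φ x))
      - ∫ x in U, deriv ψ (φ x) * h x
      = (t n)⁻¹ * ((∫ x in U, ψ ((φ + t n • h : LInf Ω) x)) - (∫ x in U, ψ (φ x))
        - t n * ∫ x in U, deriv ψ (φ x) * h x) := by
    rw [mul_sub _ (_ - _) (t n * _), inv_mul_cancel_left₀ (ht0 n)]
  rw [h3, norm_mul, norm_inv, Real.norm_eq_abs (t n), inv_mul_le_iff₀ (abs_pos.2 (ht0 n))]
  exact h2.trans_eq (by ring)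

variable {S₀ S₁ : Set (Rn d)}

theorem freeRegion_subset : freeRegion Ω S₀ S₁ ⊆ Ω := sdiff_subset

theorem energy_eq (hfin : volume (freeRegion Ω S₀ S₁) ≠ ⊤) (ε : ℝ) {ψ₀ : ℝ → ℝ}
    (hψ : Continuous ψ₀) (φ : LInf Ω) :
    energy Ω S₀ S₁ ε ψ₀ φ = ε / 2 * ‖weakGrad (freeRegion Ω S₀ S₁) φ‖ ^ 2
      + 1 / ε * ∫ x in freeRegion Ω S₀ S₁, ψ₀ (φ x) := by
  rw [energy, integral_add, integral_const_mul, integral_const_mul, sq_norm_eq_integral]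
  · exact (Lp.memLp (weakGrad (freeRegion Ω S₀ S₁) φ)).norm.integrable_sq.const_mul _
  · exact (integrable_of_isWeight freeRegion_subset hfin (isWeight_comp hψ φ)).const_mul _

/-- The directional derivative of the Ginzburg–Landau energy. -/
theorem tendsto_slope_energy (hopen : IsOpen (freeRegion Ω S₀ S₁))
    (hfin : volume (freeRegion Ω S₀ S₁) ≠ ⊤) (ε : ℝ) {ψ₀ : ℝ → ℝ} (hψ : C11Loc ψ₀)
    {φ h : LInf Ω} (hφ : MemH1 (freeRegion Ω S₀ S₁) φ) (hh : MemH1 (freeRegion Ω S₀ S₁) h)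
    {t : ℕ → ℝ} (ht : Tendsto t atTop (𝓝 0)) (ht0 : ∀ n, t n ≠ 0) (ht1 : ∀ n, |t n| ≤ 1) :
    Tendsto (fun n => (t n)⁻¹ *
        (energy Ω S₀ S₁ ε ψ₀ (φ + t n • h) - energy Ω S₀ S₁ ε ψ₀ φ)) atTop
      (𝓝 (ε * (∫ x in freeRegion Ω S₀ S₁,
          ⟪weakGrad (freeRegion Ω S₀ S₁) φ x, weakGrad (freeRegion Ω S₀ S₁) h x⟫)
        + 1 / ε * ∫ x in freeRegion Ω S₀ S₁, deriv ψ₀ (φ x) * h x)) := by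
  set U := freeRegion Ω S₀ S₁ with hUdef
  have hUΩ : U ⊆ Ω := freeRegion_subset
  rw [← L2.inner_def]
  -- The Dirichlet part is exactly quadratic in the step, so its difference quotient is explicit.
  have h1 : Tendsto (fun n => ε * (⟪weakGrad U φ, weakGrad U h⟫
      + t n * (‖weakGrad U h‖ ^ 2 / 2))) atTop (𝓝 (ε * ⟪weakGrad U φ, weakGrad U h⟫)) := by
    have := ((ht.mul_const (‖weakGrad U h‖ ^ 2 / 2)).const_add
      ⟪weakGrad U φ, weakGrad U h⟫).const_mul ε
    simpa using this
  refine (h1.add ((tendsto_slope_integral_comp hUΩ hfin hψ φ h ht ht0 ht1).const_mul (1 / ε))).congr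
    fun n => ?_
  rw [energy_eq hfin ε hψ.continuous, energy_eq hfin ε hψ.continuous, ← hUdef,
    weakGrad_add_smul hopen hUΩ hφ hh, norm_add_sq_real, norm_smul, real_inner_smul_right, mul_pow,
    Real.norm_eq_abs, sq_abs]
  have := ht0 n
  field_simp
  ring

/-- The admissible set is convex. -/
theorem add_smul_sub_mem_admissible {β₁ β₂ : ℝ} (hfin : volume (freeRegion Ω S₀ S₁) ≠ ⊤)
    (hS₀ : S₀ ⊆ Ω) (hS₁ : S₁ ⊆ Ω) {φ ϑ : LInf Ω} (hφ : φ ∈ admissible Ω S₀ S₁ β₁ β₂)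
    (hϑ : ϑ ∈ admissible Ω S₀ S₁ β₁ β₂) {t : ℝ} (ht0 : 0 ≤ t) (ht1 : t ≤ 1) :
    φ + t • (ϑ - φ) ∈ admissible Ω S₀ S₁ β₁ β₂ := by
  obtain ⟨⟨h1, h2, h3, h4⟩, h5, h6⟩ := hφ
  obtain ⟨⟨k1, k2, k3, k4⟩, k5, k6⟩ := hϑ
  have hUΩ : freeRegion Ω S₀ S₁ ⊆ Ω := freeRegion_subset
  have hae : ∀ᵐ x ∂volume.restrict Ω,
      (φ + t • (ϑ - φ) : LInf Ω) x = (1 - t) * φ x + t * ϑ x := by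
    filter_upwards [coeFn_add_smul φ (ϑ - φ) t, Lp.coeFn_sub ϑ φ] with x hx hx'
    rw [hx, hx', Pi.sub_apply]
    ring
  have hint : ∫ x in freeRegion Ω S₀ S₁, (φ + t • (ϑ - φ) : LInf Ω) x
      = (1 - t) * (∫ x in freeRegion Ω S₀ S₁, φ x) + t * ∫ x in freeRegion Ω S₀ S₁, ϑ x := by
    rw [integral_congr_ae (ae_restrict_of_subset hUΩ hae), integral_add, integral_const_mul,
      integral_const_mul]
    · exact (integrable_of_isWeight hUΩ hfin (isWeight_coeFn φ)).const_mul _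
    · exact (integrable_of_isWeight hUΩ hfin (isWeight_coeFn ϑ)).const_mul _
  have ht2 : 0 ≤ 1 - t := by linarith
  refine ⟨⟨h1.add_smul hUΩ (k1.sub hUΩ h1) t, ?_, ?_, ?_⟩, ?_, ?_⟩
  · filter_upwards [ae_restrict_of_subset hUΩ hae, h2, k2] with x hx hx1 hx2
    rw [hx]
    refine (abs_add_le _ _).trans ?_
    rw [abs_mul, abs_mul, abs_of_nonneg ht2, abs_of_nonneg ht0]
    nlinarith
  · rw [hint]
    nlinarith
  · rw [hint]
    nlinarith
  · filter_upwards [ae_restrict_of_subset hS₀ hae, h5, k5] with x hx hx1 hx2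
    rw [hx, hx1, hx2]
    ring
  · filter_upwards [ae_restrict_of_subset hS₁ hae, h6, k6] with x hx hx1 hx2
    rw [hx, hx1, hx2]
    ring

/-- The first order condition at a local minimizer, along a sequence of step sizes. -/
theorem IsLocalMinimizer.nonneg_of_tendsto_slope {β₁ β₂ : ℝ} {J : LInf Ω → ℝ} {φ : LInf Ω}
    (hφ : IsLocalMinimizer Ω S₀ S₁ β₁ β₂ J φ) (hfin : volume (freeRegion Ω S₀ S₁) ≠ ⊤)
    (hS₀ : S₀ ⊆ Ω) (hS₁ : S₁ ⊆ Ω) {ϑ : LInf Ω} (hϑ : ϑ ∈ admissible Ω S₀ S₁ β₁ β₂) {t : ℕ → ℝ}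
    (ht : Tendsto t atTop (𝓝 0)) (ht0 : ∀ n, 0 ≤ t n) (ht1 : ∀ n, t n ≤ 1) {D : ℝ}
    (hD : Tendsto (fun n => (t n)⁻¹ * (J (φ + t n • (ϑ - φ)) - J φ)) atTop (𝓝 D)) : 0 ≤ D := by
  obtain ⟨hadm, δ, hδ, hmin⟩ := hφ
  refine ge_of_tendsto hD ?_
  have h1 : Tendsto (fun n => ‖t n • (ϑ - φ)‖) atTop (𝓝 0) := by
    simpa using (ht.smul_const (ϑ - φ)).norm
  filter_upwards [h1.eventually_lt_const hδ] with n hn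
  refine mul_nonneg (inv_nonneg.2 (ht0 n)) (sub_nonneg.2 (hmin _ ?_ ?_))
  · exact add_smul_sub_mem_admissible hfin hS₀ hS₁ hadm hϑ (ht0 n) (ht1 n)
  · rwa [add_sub_cancel_left]

/-- The chain rule along a sequence of difference quotients. -/
theorem tendsto_slope_comp {l : ℕ} {Ψ : (Fin l → ℝ) → ℝ} {x : Fin l → ℝ}
    (hΨ : DifferentiableAt ℝ Ψ x) {t : ℕ → ℝ} (ht : Tendsto t atTop (𝓝 0)) (ht0 : ∀ n, t n ≠ 0)
    {y : ℕ → Fin l → ℝ} {v : Fin l → ℝ}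
    (hy : ∀ j, Tendsto (fun n => (t n)⁻¹ * (y n j - x j)) atTop (𝓝 (v j))) :
    Tendsto (fun n => (t n)⁻¹ * (Ψ (y n) - Ψ x)) atTop
      (𝓝 (∑ j, fderiv ℝ Ψ x (Pi.single j 1) * v j)) := by
  have h1 : Tendsto (fun n => (t n)⁻¹ • (y n - x)) atTop (𝓝 v) := tendsto_pi_nhds.2 hy
  have h2 : Tendsto (fun n => y n - x) atTop (𝓝 0) := by
    have := ht.smul h1
    rw [zero_smul] at this
    exact this.congr fun n => smul_inv_smul₀ (ht0 n) _
  -- Scaling the increments by `(t n)⁻¹` makes them converge to `v`, so differentiability gives the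
  -- limit without any path between the sampled points.
  have h3 := hΨ.hasFDerivAt.hasFDerivWithinAt.lim (s := univ) (c := fun n => (t n)⁻¹)
    (d := fun n => y n - x) (v := v) h2 (by simp) h1
  have h4 : fderiv ℝ Ψ x v = ∑ j, fderiv ℝ Ψ x (Pi.single j 1) * v j := by
    conv_lhs => rw [pi_eq_sum_univ' v]
    simp [map_sum, mul_comm]
  rw [← h4]
  simpa using h3

/-- The eigenspace of a simple eigenvalue is spanned by any eigenfunction. -/
theorem IsSimpleEigenvalue.eq_smul_of_ne_zero {a c : ℝ → ℝ} {φ : LInf Ω} {μ : ℝ}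
    (h : IsSimpleEigenvalue Ω a c φ μ) {w : H1 Ω} (hw : IsEigenfunction Ω a c φ μ w) :
    ∀ v : H1 Ω, IsWeakNeumannSolution Ω a c φ μ v → ∃ ξ : ℝ, v = ξ • w := by
  intro v hv
  obtain ⟨w₀, -, h₀⟩ := h
  obtain ⟨ξ, rfl⟩ := h₀ v hv
  obtain ⟨ξ₀, rfl⟩ := h₀ w hw.2
  have hξ₀ : ξ₀ ≠ 0 := fun h => hw.1 (by rw [h, zero_smul])
  exact ⟨ξ / ξ₀, by rw [smul_smul, div_mul_cancel₀ _ hξ₀]⟩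

end Energy

end PhaseFieldNeumann

/-! ### The optimality system. -/

theorem mainTheorem8 {d : ℕ} (hd : 1 ≤ d)
    -- the design domain and the regions where the pure phases are prescribed
    (Ω S₀ S₁ : Set (Rn d))
    (hΩ_open : IsOpen Ω) (hΩ_conn : IsConnected Ω) (hΩ_bdd : Bornology.IsBounded Ω)
    (hΩ_lip : HasLipschitzBoundary Ω)
    (hS₀ : MeasurableSet S₀) (hS₁ : MeasurableSet S₁) (hS₀Ω : S₀ ⊆ Ω) (hS₁Ω : S₁ ⊆ Ω)
    (hS : Disjoint S₀ S₁)
    (hfree_open : IsOpen (freeRegion Ω S₀ S₁))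
    (hfree_lip : HasLipschitzBoundary (freeRegion Ω S₀ S₁))
    -- the mean value constraint
    (β₁ β₂ : ℝ) (hβ : β₁ ≤ β₂) (hβ₁ : β₁ ∈ Ioo (-1 : ℝ) 1) (hβ₂ : β₂ ∈ Ioo (-1 : ℝ) 1)
    -- interface parameter, weight, potential and coefficients
    (ε γ : ℝ) (hε : 0 < ε) (hγ : 0 < γ)
    (ψ₀ : ℝ → ℝ) (hψ₀ : IsDoubleObstacle ψ₀)
    (a c : ℝ → ℝ) (ha : C11Loc a) (hc : C11Loc c)
    (hac : ∃ C : ℝ, 0 < C ∧ ∀ s, C < a s ∧ C < c s)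
    -- the selected eigenvalues and the function in the cost functional
    {l : ℕ} (i : Fin l → ℕ) (hi : StrictMono i) (hi0 : ∀ j, 0 < i j)
    (Ψ : (Fin l → ℝ) → ℝ) (hΨ : ContDiffOn ℝ 1 Ψ {y | ∀ j, 0 < y j})
    -- the local minimizer
    (φ : LInf Ω)
    (hφ : IsLocalMinimizer Ω S₀ S₁ β₁ β₂ (cost Ω S₀ S₁ ε γ a c ψ₀ i Ψ) φ)
    (hsimple : ∀ j, IsSimpleEigenvalue Ω a c φ (neumannEigenvalue Ω a c φ (i j))) :
    -- the eigenvalue vector lies in the domain of the cost function, eigenfunctions as below exist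
    (∀ j, 0 < neumannEigenvalue Ω a c φ (i j)) ∧
    (∀ j, ∃ w : H1 Ω,
      IsNormalizedEigenfunction Ω a c φ (neumannEigenvalue Ω a c φ (i j)) w) ∧
    ∀ w : Fin l → H1 Ω,
      (∀ j, IsNormalizedEigenfunction Ω a c φ (neumannEigenvalue Ω a c φ (i j)) (w j)) →
      -- the state equations
      (∀ j, IsWeakNeumannSolution Ω a c φ (neumannEigenvalue Ω a c φ (i j)) (w j)) ∧
      -- the variational inequality
      ∀ ϑ ∈ admissible Ω S₀ S₁ β₁ β₂,
        0 ≤ γ * ε * (∫ x in freeRegion Ω S₀ S₁,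
              inner ℝ (weakGrad (freeRegion Ω S₀ S₁) φ x)
                (weakGrad (freeRegion Ω S₀ S₁) (ϑ - φ : LInf Ω) x))
          + γ / ε * (∫ x in freeRegion Ω S₀ S₁, deriv ψ₀ (φ x) * (ϑ x - φ x))
          + ∑ j, fderiv ℝ Ψ (eigenvalueVector Ω a c i φ) (Pi.single j 1) *
              (wform Ω (fun x => deriv a (φ x) * (ϑ x - φ x)) (gradH1 (w j)) (gradH1 (w j))
                - neumannEigenvalue Ω a c φ (i j) *
                  wform Ω (fun x => deriv c (φ x) * (ϑ x - φ x)) (valH1 (w j)) (valH1 (w j))) := by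
  obtain ⟨C, hC, hCac⟩ := hac
  have haC : ∀ s, C ≤ a s := fun s => (hCac s).1.le
  have hcC : ∀ s, C ≤ c s := fun s => (hCac s).2.le
  have hne : Ω.Nonempty := hΩ_conn.nonempty
  have hpos : ∀ j, 0 < neumannEigenvalue Ω a c φ (i j) := fun j =>
    neumannEigenvalue_pos hd hΩ_open hΩ_bdd hne hΩ_lip ha.continuous hc.continuous hC haC hcC φ
      (hi0 j) (hsimple j)
  refine ⟨hpos, fun j => ?_, fun w hw => ⟨fun j => (hw j).isEigenfunction.2, fun ϑ hϑ => ?_⟩⟩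
  · obtain ⟨w, hw, -⟩ := hsimple j
    exact exists_isNormalizedEigenfunction hΩ_open hΩ_bdd hc.continuous hC hcC (hpos j).ne' hw
  have hfin : volume (freeRegion Ω S₀ S₁) ≠ ⊤ :=
    (hΩ_bdd.subset freeRegion_subset).measure_lt_top.ne
  -- Positive steps of size at most one: they keep `φ + t n • (ϑ - φ)` on the segment inside the
  -- convex admissible set.
  set t : ℕ → ℝ := fun n => 1 / ((n : ℝ) + 1) with ht_def
  have ht : Filter.Tendsto t Filter.atTop (𝓝 0) := tendsto_one_div_add_atTop_nhds_zero_nat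
  have htpos : ∀ n, 0 < t n := fun n => Nat.one_div_pos_of_nat
  have htle : ∀ n, t n ≤ 1 := fun n => by
    rw [ht_def, div_le_one (by positivity)]
    linarith [(Nat.cast_nonneg n : (0 : ℝ) ≤ n)]
  have ht0 : ∀ n, t n ≠ 0 := fun n => (htpos n).ne'
  have ht1 : ∀ n, |t n| ≤ 1 := fun n => by rw [abs_of_pos (htpos n)]; exact htle n
  have hslope : ∀ j, Filter.Tendsto (fun n => (t n)⁻¹ *
      (eigenvalueVector Ω a c i (φ + t n • (ϑ - φ)) j - eigenvalueVector Ω a c i φ j))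
      Filter.atTop (𝓝 _) := fun j =>
    tendsto_slope_neumannEigenvalue hd hΩ_open hΩ_bdd hne hΩ_lip ha hc hC haC hcC φ (ϑ - φ)
      ht ht0 ht1 (hw j).isEigenfunction.2 (hw j).normalized
      ((hsimple j).eq_smul_of_ne_zero (hw j).isEigenfunction)
  -- `Ψ` is regular only on the open positive orthant, which contains the eigenvalue vector by
  -- `hpos`.
  have hdiff : DifferentiableAt ℝ Ψ (eigenvalueVector Ω a c i φ) := by
    refine (hΨ.contDiffAt (IsOpen.mem_nhds ?_ hpos)).differentiableAt one_ne_zero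
    simp only [ofPred_forall]
    exact isOpen_iInter_of_finite fun j => isOpen_lt continuous_const (continuous_apply j)
  have hJ := (tendsto_slope_comp hdiff ht ht0 hslope).add
    ((tendsto_slope_energy hfree_open hfin ε hψ₀.regular hφ.1.1.1
      (hϑ.1.1.sub freeRegion_subset hφ.1.1.1) ht ht0 ht1).const_mul γ)
  have hsub := Lp.coeFn_sub ϑ φ
  have h0 := hφ.nonneg_of_tendsto_slope hfin hS₀Ω hS₁Ω hϑ ht (fun n => (htpos n).le) htle
    (hJ.congr fun n => by simp only [cost]; ring)
  refine h0.trans_eq ?_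
  -- In `L^∞` the difference `ϑ - φ` equals the pointwise difference only almost everywhere; the
  -- integrals are adjusted accordingly.
  have hψ : ∫ x in freeRegion Ω S₀ S₁, deriv ψ₀ (φ x) * (ϑ - φ : LInf Ω) x
      = ∫ x in freeRegion Ω S₀ S₁, deriv ψ₀ (φ x) * (ϑ x - φ x) := by
    refine integral_congr_ae ?_
    filter_upwards [ae_restrict_of_subset freeRegion_subset hsub] with x hx
    rw [hx, Pi.sub_apply]
  have hwf : ∀ {f : ℝ → ℝ} {F : Type} [NormedAddCommGroup F] [InnerProductSpace ℝ F]
      (u : Rn d → F), wform Ω (fun x => deriv f (φ x) * (ϑ - φ : LInf Ω) x) u u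
        = wform Ω (fun x => deriv f (φ x) * (ϑ x - φ x)) u u := fun u => by
    refine integral_congr_ae ?_
    filter_upwards [hsub] with x hx
    rw [hx, Pi.sub_apply]
  simp only [hψ, hwf]
  ring
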